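/- Let $n,N$ be positive integers with $N\ge n$, let $\theta\in\mathbb R^n$, $C\in\mathbb R$, $\beta>0$, $M<\infty$, $\delta>0$, and let $(\phi_k)_{k\ge1}$ be a (deterministic) sequence in $\mathbb R^n$ such that $$\sup_{k\ge 1}\|\phi_k\|\le M,\qquad \frac1N\sum_{i=k}^{k+N-1}\phi_i\phi_i^\top\ \ge\ \delta I_n\quad\text{for all }k\ge1 .$$ Let $(d_k)_{k\ge1}$ be i.i.d. real random variables with zero mean and finite variance, whose distribution function $F$ is Lipschitz continuous and which have a density $f$ with $\inf_{x\in\mathfrak X}f(x)>0$ for every bounded (nonempty) open set $\mathfrak X\subset\mathbb R$. Put $$y_k=\phi_k^\top\theta+d_k,\qquad s_k=\begin{cases}1,& y_k\le C,\\ 0,& y_k>C,\end{cases}\qquad k\ge1,$$ let $\hat\theta_0$ be an arbitrary (possibly random) initial estimate, and define $$\hat\theta_k=\hat\theta_{k-1}+\frac{\beta\phi_k}{k}\Big(F\big(C-\phi_k^\top\hat\theta_{k-1}\big)-s_k\Big),\qquad \tilde\theta_k=\hat\theta_k-\theta,\qquad k\ge1 .$$ Let $$\underline f=\lim_{z\to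 (M\|\theta\|)^+}\ \inf_{t\in[C-z,\,C+z]}f(t),\qquad \eta=\beta\delta\underline f .$$ Then for every $\varepsilon>0$, almost surely as $k\to\infty$, $$\tilde\theta_k=\begin{cases}O\big(\sqrt{\ln\ln k/k}\big),&\eta>\tfrac12,\\[2pt] O\big(k^{-(\eta-\varepsilon)}\big),&\eta\le\tfrac12.\end{cases}$$ If moreover $f$ is locally Lipschitz continuous, then almost surely as $k\to\infty$, $$\tilde\theta_k=\begin{cases}O\big(\sqrt{\ln\ln k/k}\big),&\eta>\tfrac12,\\[2pt] O\big(\ln k\,\sqrt{\ln\ln k/k}\big),&\eta=\tfrac12,\\[2pt] O\big(k^{-\eta}\big),&\eta<\tfrac12.\end{cases}$$ -/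

import Mathlib

open scoped Topology
open Filter MeasureTheory ProbabilityTheory Asymptotics

namespace SetValued

/-- Uniformly bounded regressors (indexed by `k ≥ 1`) with uniform persistent excitation:
`(1/N) ∑_{i=k}^{k+N-1} φ_i φ_iᵀ ≥ δ I_n` in the Loewner order, for every `k ≥ 1`. -/
structure PersistentExcitation {n : ℕ} (φ : ℕ → EuclideanSpace ℝ (Fin n))
    (M δ : ℝ) (N : ℕ) : Prop where
  bounded : ∀ k, 1 ≤ k → ‖φ k‖ ≤ M
  window_pos : 0 < N
  dim_le_window : n ≤ N
  delta_pos : 0 < δ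
  exciting : ∀ k, 1 ≤ k →
    ((1 / (N : ℝ)) • ∑ i ∈ Finset.Ico k (k + N), Matrix.vecMulVec (φ i).ofLp (φ i).ofLp
      - δ • (1 : Matrix (Fin n) (Fin n) ℝ)).PosSemidef

/-- The noise `d_1, d_2, …` is i.i.d. with zero mean and finite variance, its distribution
function `F` is Lipschitz, and `f` is a density of it which is bounded below by a positive
constant on each bounded open set. -/
structure NoiseAssumption {Ω : Type*} [MeasurableSpace Ω] (μ : Measure Ω)
    (d : ℕ → Ω → ℝ) (F f : ℝ → ℝ) : Prop where
  measurable : ∀ k, 1 ≤ k → Measurable (d k)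
  indep : iIndepFun (fun k : ℕ => d (k + 1)) μ
  identDistrib : ∀ k, 1 ≤ k → IdentDistrib (d k) (d 1) μ μ
  finite_variance : MemLp (d 1) 2 μ
  mean_zero : ∫ ω, d 1 ω ∂μ = 0
  distribution : ∀ x, F x = μ.real {ω | d 1 ω ≤ x}
  lipschitz : ∃ K, LipschitzWith K F
  density_measurable : Measurable f
  density : μ.map (d 1) = volume.withDensity (fun x => ENNReal.ofReal (f x))
  density_inf_pos : ∀ X : Set ℝ, IsOpen X → Bornology.IsBounded X →
    ∃ c : ℝ, 0 < c ∧ ∀ x ∈ X, c ≤ f x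

/-- The system output `y_k = φ_kᵀ θ + d_k`. -/
noncomputable def output {n : ℕ} {Ω : Type*} (φ : ℕ → EuclideanSpace ℝ (Fin n))
    (θ : EuclideanSpace ℝ (Fin n)) (d : ℕ → Ω → ℝ) (k : ℕ) (ω : Ω) : ℝ :=
  inner ℝ (φ k) θ + d k ω

/-- The binary observation `s_k`, equal to `1` if `y_k ≤ C` and to `0` if `y_k > C`. -/
noncomputable def observation {n : ℕ} {Ω : Type*} (φ : ℕ → EuclideanSpace ℝ (Fin n))
    (θ : EuclideanSpace ℝ (Fin n)) (d : ℕ → Ω → ℝ) (C : ℝ) (k : ℕ) (ω : Ω) : ℝ :=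
  if output φ θ d k ω ≤ C then 1 else 0

/-- The recursion `x_k = x_{k-1} + (β φ_k / k) (F (C - φ_kᵀ x_{k-1}) - s_k)`, `k ≥ 1`,
driven by a sequence of observations `s`, started at `x₀`. -/
noncomputable def recursion {n : ℕ} (β C : ℝ) (F : ℝ → ℝ)
    (φ : ℕ → EuclideanSpace ℝ (Fin n)) (s : ℕ → ℝ) (x₀ : EuclideanSpace ℝ (Fin n)) :
    ℕ → EuclideanSpace ℝ (Fin n)
  | 0 => x₀
  | k + 1 => recursion β C F φ s x₀ k +
      (β / ((k + 1 : ℕ) : ℝ) *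
        (F (C - inner ℝ (φ (k + 1)) (recursion β C F φ s x₀ k)) - s (k + 1))) • φ (k + 1)

/-- The estimate of `θ` at time `k`, with initial estimate `θ₀`. -/
noncomputable def estimate {n : ℕ} {Ω : Type*} (β C : ℝ) (F : ℝ → ℝ)
    (φ : ℕ → EuclideanSpace ℝ (Fin n)) (θ : EuclideanSpace ℝ (Fin n)) (d : ℕ → Ω → ℝ)
    (θ₀ : Ω → EuclideanSpace ℝ (Fin n)) (k : ℕ) (ω : Ω) : EuclideanSpace ℝ (Fin n) :=
  recursion β C F φ (fun j => observation φ θ d C j ω) (θ₀ ω) k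

/-- The estimation error at time `k`: the estimate minus `θ`. -/
noncomputable def estimationError {n : ℕ} {Ω : Type*} (β C : ℝ) (F : ℝ → ℝ)
    (φ : ℕ → EuclideanSpace ℝ (Fin n)) (θ : EuclideanSpace ℝ (Fin n)) (d : ℕ → Ω → ℝ)
    (θ₀ : Ω → EuclideanSpace ℝ (Fin n)) (k : ℕ) (ω : Ω) : EuclideanSpace ℝ (Fin n) :=
  estimate β C F φ θ d θ₀ k ω - θ

/-- `lowerDensity f C a = lim_{z → a⁺} inf_{t ∈ [C - z, C + z]} f t`. -/
noncomputable def lowerDensity (f : ℝ → ℝ) (C a : ℝ) : ℝ :=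
  limUnder (𝓝[>] a) (fun z => sInf (f '' Set.Icc (C - z) (C + z)))

/-- The limit that defines `lowerDensity` exists. -/
theorem tendsto_lowerDensity {f : ℝ → ℝ} (hf : ∀ x, 0 ≤ f x) (C : ℝ) {a : ℝ} (ha : 0 ≤ a) :
    Tendsto (fun z => sInf (f '' Set.Icc (C - z) (C + z))) (𝓝[>] a)
      (𝓝 (lowerDensity f C a)) := by
  have hbdd : ∀ s : Set ℝ, BddBelow (f '' s) := fun s =>
    ⟨0, by rintro _ ⟨x, -, rfl⟩; exact hf x⟩
  have hanti : AntitoneOn (fun z => sInf (f '' Set.Icc (C - z) (C + z))) (Set.Ioi a) := by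
    intro z hz w hw hzw
    have hz' : a < z := hz
    refine csInf_le_csInf (hbdd _) ⟨f C, C, ⟨by linarith, by linarith⟩, rfl⟩ ?_
    exact Set.image_mono (Set.Icc_subset_Icc (by linarith) (by linarith))
  have hub : BddAbove ((fun z => sInf (f '' Set.Icc (C - z) (C + z))) '' Set.Ioi a) := by
    refine ⟨f C, ?_⟩
    rintro _ ⟨z, hz, rfl⟩
    have hz' : a < z := hz
    exact csInf_le (hbdd _) ⟨C, ⟨by linarith, by linarith⟩, rfl⟩
  exact tendsto_nhds_limUnder ⟨_, hanti.tendsto_nhdsGT hub⟩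

end SetValued

/-!
**Idea.** With secant slopes of `F` as gains, the estimation error obeys a formally linear
recursion with steps `1 / k` and independent bounded noise. Subtracting the running mean of the
noise, which the law of the iterated logarithm bounds by `√(log log k / k)`, leaves a recursion
whose perturbations are smaller by a factor `1 / k`.

While the gains stay above `α`, persistent excitation makes the homogeneous recursion contract over
long windows like `k ^ (-(α * δ))`. With the positive gains available on a bounded set this first
gives convergence to `0`, and then the gains are asymptotically at least
`β * lowerDensity f C (M * ‖θ‖)`. If `f` is locally Lipschitz, the gains fall short of this limit by
only the order of the error itself, so that the limit itself can serve as gain.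

The logarithmic law is only needed as an upper bound, for sub-Gaussian sums; a maximal inequality
and a Chernoff bound on dyadic blocks suffice.
-/

namespace SetValued

section IteratedLogarithm

open scoped NNReal

variable {Ω : Type*} [MeasurableSpace Ω] {μ : Measure Ω}

theorem integral_eq_zero_of_hasSubgaussianMGF [IsProbabilityMeasure μ] {X : Ω → ℝ} {c : ℝ≥0}
    (hX : HasSubgaussianMGF X c μ) : μ[X] = 0 := by
  have h0 : (0 : ℝ) ∈ interior (integrableExpSet X μ) := by simp [hX.integrableExpSet_eq_univ]
  have hmin : IsLocalMin (fun t : ℝ => Real.exp (c * t ^ 2 / 2) - mgf X μ t) 0 :=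
    Eventually.of_forall fun t => by simpa using hX.mgf_le t
  have hexp : HasDerivAt (fun t : ℝ => Real.exp (c * t ^ 2 / 2)) 0 0 := by
    simpa using ((((hasDerivAt_id (0 : ℝ)).pow 2).const_mul (c : ℝ)).div_const 2).exp
  simpa using hmin.hasDerivAt_eq_zero (hexp.sub (hasDerivAt_mgf h0))

theorem hasSubgaussianMGF_mono {X : Ω → ℝ} {c c' : ℝ≥0} (hX : HasSubgaussianMGF X c μ)
    (hcc' : c ≤ c') : HasSubgaussianMGF X c' μ where
  integrable_exp_mul := hX.integrable_exp_mul
  mgf_le t := (hX.mgf_le t).trans (by gcongr)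

theorem one_le_mgf_of_hasSubgaussianMGF [IsProbabilityMeasure μ] {X : Ω → ℝ} {c : ℝ≥0}
    (hX : HasSubgaussianMGF X c μ) (t : ℝ) : 1 ≤ mgf X μ t := by
  have htX : Integrable (fun ω => t * X ω) μ := hX.integrable.const_mul t
  calc (1 : ℝ) = ∫ ω, (t * X ω + 1) ∂μ := by
        rw [integral_add htX (integrable_const _), integral_const_mul,
          integral_eq_zero_of_hasSubgaussianMGF hX]
        simp
    _ ≤ mgf X μ t := integral_mono (htX.add (integrable_const _)) (hX.integrable_exp_mul t)
        fun ω => Real.add_one_le_exp _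

variable [IsProbabilityMeasure μ] {X : ℕ → Ω → ℝ} {c : ℝ≥0}

theorem submartingale_exp_sum (hX : ∀ i, Measurable (X i)) (hind : iIndepFun X μ)
    (hsub : ∀ i, HasSubgaussianMGF (X i) c μ) (t : ℝ) :
    Submartingale (fun n ω => Real.exp (t * ∑ i ∈ Finset.range (n + 1), X i ω))
      (Filtration.natural X fun i => (hX i).stronglyMeasurable) μ := by
  set 𝒢 := Filtration.natural X fun i => (hX i).stronglyMeasurable
  have hadapted : ∀ n, Measurable[𝒢 n]
      fun ω => Real.exp (t * ∑ i ∈ Finset.range (n + 1), X i ω) := fun n =>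
    Real.measurable_exp.comp <| (Finset.measurable_fun_sum _ fun i hi =>
      ((Filtration.stronglyAdapted_natural fun i => (hX i).stronglyMeasurable) i).measurable.mono
        (𝒢.mono (by simpa [Nat.lt_succ_iff] using hi)) le_rfl).const_mul t
  refine submartingale_of_setIntegral_le_succ (fun n => (hadapted n).stronglyMeasurable)
    (fun n => (HasSubgaussianMGF.sum_of_iIndepFun hind fun i _ => hsub i).integrable_exp_mul t)
    fun n s hs => ?_
  have hsΩ : MeasurableSet s := 𝒢.le n _ hs
  have hstopped := (hadapted n).indicator hs
  have hindep : IndepFun (s.indicator fun ω => Real.exp (t * ∑ i ∈ Finset.range (n + 1), X i ω))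
      (fun ω => Real.exp (t * X (n + 1) ω)) μ := by
    have hpast := hind.indep_comap_natural_of_lt (fun i => (hX i).stronglyMeasurable)
      (Nat.lt_succ_self n)
    have hX' := (indep_of_indep_of_le_right hpast hstopped.comap_le).symm
    exact ((IndepFun_iff_Indep _ _ _).2 hX').comp measurable_id
      (ψ := fun x : ℝ => Real.exp (t * x)) (by fun_prop)
  have hfactor : (s.indicator fun ω => Real.exp (t * ∑ i ∈ Finset.range (n + 1 + 1), X i ω)) =
      (s.indicator fun ω => Real.exp (t * ∑ i ∈ Finset.range (n + 1), X i ω)) *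
        fun ω => Real.exp (t * X (n + 1) ω) := by
    funext ω
    by_cases hω : ω ∈ s
    · simp [hω, Finset.sum_range_succ _ (n + 1), mul_add, Real.exp_add]
    · simp [hω]
  rw [← integral_indicator hsΩ, ← integral_indicator hsΩ, hfactor,
    hindep.integral_mul_eq_mul_integral (hstopped.mono (𝒢.le n) le_rfl).aestronglyMeasurable
      (by fun_prop)]
  exact le_mul_of_one_le_right
    (integral_nonneg fun ω => Set.indicator_nonneg (fun _ _ => (Real.exp_pos _).le) _)
    (one_le_mgf_of_hasSubgaussianMGF (hsub _) t)

theorem measure_exists_le_sum_le_exp (hX : ∀ i, Measurable (X i)) (hind : iIndepFun X μ)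
    (hsub : ∀ i, HasSubgaussianMGF (X i) c μ) {t : ℝ} (ht : 0 ≤ t) (a : ℝ) (n : ℕ) :
    μ {ω | ∃ k ≤ n, a ≤ ∑ i ∈ Finset.range (k + 1), X i ω} ≤
      ENNReal.ofReal (Real.exp (-(t * a) + (n + 1) * c * t ^ 2 / 2)) := by
  have hsum : HasSubgaussianMGF (fun ω => ∑ i ∈ Finset.range (n + 1), X i ω)
      (∑ _i ∈ Finset.range (n + 1), c) μ :=
    HasSubgaussianMGF.sum_of_iIndepFun hind fun i _ => hsub i
  have hdoob := maximal_ineq (submartingale_exp_sum hX hind hsub t)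
    (fun n ω => (Real.exp_pos _).le) (ε := (Real.exp (t * a)).toNNReal) n
  simp only [Real.coe_toNNReal _ (Real.exp_pos _).le] at hdoob
  set E := {ω | Real.exp (t * a) ≤ (Finset.range (n + 1)).sup' Finset.nonempty_range_add_one
    fun k => Real.exp (t * ∑ i ∈ Finset.range (k + 1), X i ω)} with hE
  have hsubset : {ω | ∃ k ≤ n, a ≤ ∑ i ∈ Finset.range (k + 1), X i ω} ⊆ E := by
    rintro ω ⟨k, hk, hak⟩
    simp only [hE, Set.mem_ofPred_eq, Finset.le_sup'_iff]
    exact ⟨k, by simpa [Nat.lt_succ_iff] using hk,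
      Real.exp_le_exp.2 (mul_le_mul_of_nonneg_left hak ht)⟩
  have hmgf : ∫ ω in E, Real.exp (t * ∑ i ∈ Finset.range (n + 1), X i ω) ∂μ ≤
      Real.exp ((n + 1) * c * t ^ 2 / 2) := by
    refine (setIntegral_le_integral (hsum.integrable_exp_mul t)
      (ae_of_all _ fun ω => (Real.exp_pos _).le)).trans ((hsum.mgf_le t).trans_eq ?_)
    simp
  refine (measure_mono hsubset).trans ?_
  rw [Real.exp_add, ENNReal.ofReal_mul (Real.exp_pos _).le, Real.exp_neg,
    ENNReal.ofReal_inv_of_pos (Real.exp_pos _), mul_comm, ← div_eq_mul_inv,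
    ENNReal.le_div_iff_mul_le (Or.inl (by simp [Real.exp_pos])) (Or.inl ENNReal.ofReal_ne_top),
    mul_comm]
  exact hdoob.trans (ENNReal.ofReal_le_ofReal hmgf)

theorem eventually_log_le_two_mul_log_log :
    ∀ᶠ j : ℕ in atTop, ∀ k : ℕ, 2 ^ j ≤ k → Real.log j ≤ 2 * Real.log (Real.log k) := by
  have : (0 : ℝ) < Real.log 2 := Real.log_pos one_lt_two
  filter_upwards [tendsto_natCast_atTop_atTop.eventually_ge_atTop (1 / Real.log 2 ^ 2),
    eventually_gt_atTop 0] with j hj hj0 k hk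
  have hj0' : (0 : ℝ) < j := by exact_mod_cast hj0
  have hlogk : j * Real.log 2 ≤ Real.log k := by
    rw [← Real.log_pow]
    exact Real.log_le_log (by positivity) (by exact_mod_cast hk)
  calc Real.log j ≤ Real.log ((j * Real.log 2) ^ 2) := by
        refine Real.log_le_log hj0' ?_
        rw [div_le_iff₀ (by positivity)] at hj
        nlinarith
    _ = 2 * Real.log (j * Real.log 2) := by simp [Real.log_pow]
    _ ≤ 2 * Real.log (Real.log k) := by gcongr

theorem measure_exists_dyadic_le_sum_le (hX : ∀ i, Measurable (X i)) (hind : iIndepFun X μ)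
    (hc : 0 < c) (hsub : ∀ i, HasSubgaussianMGF (X i) c μ) {j : ℕ} (hj : 1 ≤ j) :
    μ {ω | ∃ k ≤ 2 ^ (j + 1) - 1,
        2 * √(c * (2 ^ (j + 1) * Real.log j)) ≤ ∑ i ∈ Finset.range (k + 1), X i ω} ≤
      ENNReal.ofReal (1 / (j : ℝ) ^ 2) := by
  have hj' : (1 : ℝ) ≤ j := by exact_mod_cast hj
  have : (0 : ℝ) < c := hc
  have : 0 ≤ Real.log j := Real.log_nonneg hj'
  set a : ℝ := 2 * √(c * (2 ^ (j + 1) * Real.log j)) with ha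
  have ha2 : a ^ 2 = 4 * (c * (2 ^ (j + 1) * Real.log j)) := by
    rw [ha, mul_pow, Real.sq_sqrt (by positivity)]; ring
  have hlen : ((2 ^ (j + 1) - 1 : ℕ) : ℝ) + 1 = 2 ^ (j + 1) := by
    rw [Nat.cast_sub Nat.one_le_two_pow]; push_cast; ring
  refine (measure_exists_le_sum_le_exp hX hind hsub (t := a / (2 ^ (j + 1) * c))
    (by positivity) a _).trans (ENNReal.ofReal_le_ofReal (le_of_eq ?_))
  have hexponent : -(a / (2 ^ (j + 1) * c) * a) +
      2 ^ (j + 1) * c * (a / (2 ^ (j + 1) * c)) ^ 2 / 2 = -Real.log ((j : ℝ) ^ 2) := by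
    calc _ = -(a ^ 2 / (2 * (2 ^ (j + 1) * c))) := by field_simp; ring
      _ = _ := by rw [ha2, Real.log_pow]; field_simp; push_cast; ring
  rw [hlen, hexponent, Real.exp_neg, Real.exp_log (by positivity), one_div]

theorem ae_eventually_sum_le_sqrt_mul_log_log (hX : ∀ i, Measurable (X i)) (hind : iIndepFun X μ)
    (hc : 0 < c) (hsub : ∀ i, HasSubgaussianMGF (X i) c μ) :
    ∀ᵐ ω ∂μ, ∀ᶠ k : ℕ in atTop,
      ∑ i ∈ Finset.range k, X i ω ≤ 4 * √(c * (k * Real.log (Real.log k))) := by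
  set a : ℕ → ℝ := fun j => 2 * √(c * (2 ^ (j + 1) * Real.log j)) with ha
  have hsum : ∑' j : ℕ, μ {ω | ∃ k ≤ 2 ^ (j + 1 + 1) - 1,
      a (j + 1) ≤ ∑ i ∈ Finset.range (k + 1), X i ω} ≠ ⊤ := by
    refine ne_top_of_le_ne_top ?_ (ENNReal.tsum_le_tsum fun j =>
      measure_exists_dyadic_le_sum_le hX hind hc hsub (Nat.le_add_left 1 j))
    exact ((summable_nat_add_iff 1).2
      (Real.summable_one_div_nat_pow.2 one_lt_two)).tsum_ofReal_ne_top
  filter_upwards [ae_eventually_notMem hsum] with ω hω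
  obtain ⟨J, hJ⟩ := eventually_atTop.1 (hω.and
    ((tendsto_add_atTop_nat 1).eventually eventually_log_le_two_mul_log_log))
  refine eventually_atTop.2 ⟨2 ^ (J + 1), fun k hk => ?_⟩
  have hk0 : k ≠ 0 := (Nat.two_pow_pos _ |>.trans_le hk).ne'
  have hJ_le : J + 1 ≤ Nat.log 2 k := (Nat.le_log_iff_pow_le one_lt_two hk0).2 hk
  obtain ⟨j, hj⟩ : ∃ j, Nat.log 2 k = j + 1 := Nat.exists_eq_add_one.2 (by omega)
  have hle : 2 ^ (j + 1) ≤ k := hj ▸ Nat.pow_log_le_self 2 hk0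
  have hlt : k < 2 ^ (j + 1 + 1) := hj ▸ Nat.lt_pow_succ_log_self one_lt_two k
  obtain ⟨hblock, hlog⟩ := hJ j (by omega)
  have hsumlt : ∑ i ∈ Finset.range k, X i ω < a (j + 1) := by
    by_contra! hc
    exact hblock ⟨k - 1, by omega, by rwa [Nat.sub_add_cancel (by omega)]⟩
  have hle' : (2 : ℝ) ^ (j + 1) ≤ k := by exact_mod_cast hle
  have : 0 ≤ Real.log (j + 1 : ℕ) := Real.log_natCast_nonneg _
  calc ∑ i ∈ Finset.range k, X i ω ≤ a (j + 1) := hsumlt.le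
    _ ≤ 2 * √(c * (2 * (k * (2 * Real.log (Real.log k))))) := by
        rw [ha]
        dsimp only
        rw [pow_succ' 2 (j + 1), mul_assoc 2 (2 ^ (j + 1) : ℝ)]
        gcongr
        exact hlog k hle
    _ = 2 * √(2 ^ 2 * (c * (k * Real.log (Real.log k)))) := by ring_nf
    _ = _ := by rw [Real.sqrt_mul (by norm_num), Real.sqrt_sq (by norm_num)]; ring

theorem ae_sum_isBigO_sqrt_mul_log_log (hX : ∀ i, Measurable (X i)) (hind : iIndepFun X μ)
    (hsub : ∀ i, HasSubgaussianMGF (X i) c μ) :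
    ∀ᵐ ω ∂μ, (fun k : ℕ => ∑ i ∈ Finset.range k, X i ω) =O[atTop]
      fun k : ℕ => √(k * Real.log (Real.log k)) := by
  have hsub' : ∀ i, HasSubgaussianMGF (X i) (c + 1) μ := fun i =>
    hasSubgaussianMGF_mono (hsub i) le_self_add
  have hneg : iIndepFun (fun i => -X i) μ := hind.comp (fun _ x => -x) fun _ => measurable_neg
  filter_upwards [ae_eventually_sum_le_sqrt_mul_log_log hX hind (by positivity) hsub',
    ae_eventually_sum_le_sqrt_mul_log_log (fun i => (hX i).neg) hneg (by positivity)
      fun i => (hsub' i).neg] with ω hupper hlower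
  refine IsBigO.of_bound (4 * √(c + 1)) ?_
  filter_upwards [hupper, hlower] with k hk hk'
  simp only [Pi.neg_apply, Finset.sum_neg_distrib, NNReal.coe_add, NNReal.coe_one] at hk hk'
  rw [Real.sqrt_mul (by positivity), ← mul_assoc] at hk hk'
  rw [Real.norm_eq_abs, Real.norm_eq_abs, abs_of_nonneg (Real.sqrt_nonneg _), abs_le]
  constructor <;> linarith

theorem ae_sum_smul_isBigO_sqrt_mul_log_log {ι : Type*} [Fintype ι]
    (hX : ∀ i, Measurable (X i)) (hind : iIndepFun X μ) (hsub : ∀ i, HasSubgaussianMGF (X i) c μ)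
    {v : ℕ → EuclideanSpace ℝ ι} {M : ℝ} (hv : ∀ k, ‖v k‖ ≤ M) :
    ∀ᵐ ω ∂μ, (fun k : ℕ => ∑ i ∈ Finset.range k, X i ω • v i) =O[atTop]
      fun k : ℕ => √(k * Real.log (Real.log k)) := by
  have hcoord : ∀ l : ι, ∀ᵐ ω ∂μ, (fun k : ℕ => ∑ i ∈ Finset.range k, v i l * X i ω) =O[atTop]
      fun k : ℕ => √(k * Real.log (Real.log k)) := by
    intro l
    refine ae_sum_isBigO_sqrt_mul_log_log (c := ⟨M ^ 2, sq_nonneg M⟩ * c)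
      (fun i => (hX i).const_mul _)
      (hind.comp (fun i x => v i l * x) fun i => measurable_const_mul _) fun i => ?_
    refine hasSubgaussianMGF_mono ((hsub i).const_mul (v i l)) (mul_le_mul_left ?_ c)
    exact sq_le_sq.2 (((PiLp.norm_apply_le (v i) l).trans (hv i)).trans (le_abs_self M))
  filter_upwards [ae_all_iff.2 hcoord] with ω hω
  refine ((EuclideanSpace.equiv ι ℝ).isBigO_comp_rev _ _).trans (isBigO_pi.2 fun l => ?_)
  refine (hω l).congr_left fun k => ?_
  simp [mul_comm]

end IteratedLogarithm

section Rates

/-- The factor `√(ln ln k)` of the law of the iterated logarithm. -/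
noncomputable def sqrtLogLog (k : ℕ) : ℝ := √(Real.log (Real.log k))

theorem eventually_one_le_sqrtLogLog : ∀ᶠ k in atTop, 1 ≤ sqrtLogLog k :=
  ((Real.tendsto_log_atTop.comp (Real.tendsto_log_atTop.comp
    tendsto_natCast_atTop_atTop)).eventually_ge_atTop 1).mono fun _ => Real.one_le_sqrt.2

theorem monotoneOn_sqrtLogLog : MonotoneOn sqrtLogLog (Set.Ici 2) := by
  intro i hi k _ hik
  have hi' : (1 : ℝ) < i := by exact_mod_cast Set.mem_Ici.1 hi
  exact Real.sqrt_le_sqrt (Real.log_le_log (Real.log_pos hi')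
    (Real.log_le_log (by linarith) (by exact_mod_cast hik)))

theorem sqrtLogLog_isBigO_rpow {τ : ℝ} (hτ : 0 < τ) :
    sqrtLogLog =O[atTop] fun k : ℕ => (k : ℝ) ^ τ := by
  refine IsBigO.trans (IsBigO.of_bound 1 ?_)
    ((isLittleO_log_rpow_atTop hτ).comp_tendsto tendsto_natCast_atTop_atTop).isBigO
  filter_upwards [eventually_one_le_sqrtLogLog] with k hk
  have hlog : 0 ≤ Real.log (k : ℝ) := Real.log_natCast_nonneg k
  have hloglog : 1 ≤ Real.log (Real.log (k : ℝ)) := Real.one_le_sqrt.1 hk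
  rw [one_mul, Function.comp_apply, Real.norm_of_nonneg hlog,
    Real.norm_of_nonneg (zero_le_one.trans hk)]
  calc sqrtLogLog k ≤ Real.log (Real.log (k : ℝ)) :=
        (Real.sqrt_le_left (by linarith)).2 (le_self_pow₀ hloglog two_ne_zero)
    _ ≤ Real.log k := Real.log_le_self hlog

theorem sqrt_mul_log_log (k : ℕ) :
    √(k * Real.log (Real.log k)) = sqrtLogLog k * (k : ℝ) ^ (1 / 2 : ℝ) := by
  rw [Real.sqrt_mul (Nat.cast_nonneg k), Real.sqrt_eq_rpow (k : ℝ), mul_comm, sqrtLogLog]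

theorem sqrt_log_log_div (k : ℕ) :
    √(Real.log (Real.log k) / k) = sqrtLogLog k * (k : ℝ) ^ (-(1 / 2) : ℝ) := by
  rw [Real.sqrt_div' _ (Nat.cast_nonneg k), Real.rpow_neg (Nat.cast_nonneg k),
    ← Real.sqrt_eq_rpow, div_eq_mul_inv, sqrtLogLog]

theorem natCast_rpow_mul_rpow_eventuallyEq (r s : ℝ) :
    (fun k : ℕ => (k : ℝ) ^ r * (k : ℝ) ^ s) =ᶠ[atTop] fun k : ℕ => (k : ℝ) ^ (r + s) := by
  filter_upwards [eventually_gt_atTop 0] with k hk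
  rw [Real.rpow_add (Nat.cast_pos.2 hk)]

theorem rpow_mul_sqrtLogLog_mul_rpow_isBigO (r s : ℝ) :
    (fun k : ℕ => (k : ℝ) ^ r * (sqrtLogLog k * (k : ℝ) ^ s)) =O[atTop]
      fun k : ℕ => sqrtLogLog k * (k : ℝ) ^ (r + s) :=
  ((isBigO_refl sqrtLogLog _).mul (natCast_rpow_mul_rpow_eventuallyEq r s).isBigO).congr_left
    fun _ => mul_left_comm _ _ _

theorem natCast_rpow_isBigO_rpow {r s : ℝ} (hrs : r ≤ s) :
    (fun k : ℕ => (k : ℝ) ^ r) =O[atTop] fun k : ℕ => (k : ℝ) ^ s := by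
  refine IsBigO.of_bound 1 ?_
  filter_upwards [eventually_ge_atTop 1] with k hk
  rw [one_mul, Real.norm_of_nonneg (by positivity), Real.norm_of_nonneg (by positivity)]
  exact Real.rpow_le_rpow_of_exponent_le (by exact_mod_cast hk) hrs

theorem sqrtLogLog_mul_rpow_isBigO_rpow {r s : ℝ} (hrs : r < s) :
    (fun k : ℕ => sqrtLogLog k * (k : ℝ) ^ r) =O[atTop] fun k : ℕ => (k : ℝ) ^ s := by
  refine ((sqrtLogLog_isBigO_rpow (sub_pos.2 hrs)).mul (isBigO_refl _ _)).trans
    (natCast_rpow_mul_rpow_eventuallyEq _ _).isBigO |>.congr_right fun k => ?_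
  rw [sub_add_cancel]

theorem natCast_rpow_isBigO_sqrtLogLog_mul_rpow {r s : ℝ} (hrs : r ≤ s) :
    (fun k : ℕ => (k : ℝ) ^ r) =O[atTop] fun k : ℕ => sqrtLogLog k * (k : ℝ) ^ s := by
  refine ((isBigO_const_left_iff_pos_le_norm one_ne_zero).2 ⟨1, one_pos, ?_⟩).mul
    (natCast_rpow_isBigO_rpow hrs) |>.congr_left fun k => one_mul _
  exact eventually_one_le_sqrtLogLog.mono fun k hk => hk.trans (Real.le_norm_self _)

theorem summable_rpow_mul_of_isBigO {u : ℕ → ℝ} {r s : ℝ} (hrs : s + r < -1)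
    (hu : u =O[atTop] fun k : ℕ => (k : ℝ) ^ r) :
    Summable fun k : ℕ => (k : ℝ) ^ s * u k :=
  summable_of_isBigO_nat (Real.summable_nat_rpow.2 hrs)
    (((isBigO_refl _ _).mul hu).trans (natCast_rpow_mul_rpow_eventuallyEq s r).isBigO)

theorem summable_rpow_mul_norm_of_isBigO {V : Type*} [SeminormedAddCommGroup V] {e : ℕ → V}
    {r s : ℝ} (hrs : s + r < -1) (he : e =O[atTop] fun k : ℕ => sqrtLogLog k * (k : ℝ) ^ r) :
    Summable fun k : ℕ => (k : ℝ) ^ s * ‖e k‖ := by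
  obtain ⟨t, hrt, ht⟩ := exists_between (by linarith : r < -1 - s)
  exact summable_rpow_mul_of_isBigO (by linarith)
    (he.trans (sqrtLogLog_mul_rpow_isBigO_rpow hrt)).norm_left

theorem sum_range_succ_rpow_sub_one_le {s : ℝ} (hs : 0 < s) (hs1 : s < 1) (k : ℕ) :
    ∑ i ∈ Finset.range (k + 1), (i : ℝ) ^ (s - 1) ≤ (k : ℝ) ^ s / s := by
  induction k with
  | zero => simp [Real.zero_rpow (by linarith : s - 1 ≠ 0), Real.zero_rpow hs.ne']
  | succ k ih =>
    have hk : (0 : ℝ) < (k + 1 : ℕ) := by positivity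
    have hinv : ((k + 1 : ℕ) : ℝ)⁻¹ ≤ 1 := inv_le_one_of_one_le₀ (by exact_mod_cast k.succ_pos)
    have hk_eq : (k : ℝ) = (k + 1 : ℕ) * (1 + -((k + 1 : ℕ) : ℝ)⁻¹) := by
      rw [mul_add, mul_neg, mul_inv_cancel₀ hk.ne', mul_one, Nat.cast_succ, add_neg_cancel_right]
    have hbernoulli : (k : ℝ) ^ s ≤ ((k + 1 : ℕ) : ℝ) ^ s - s * ((k + 1 : ℕ) : ℝ) ^ (s - 1) :=
      calc (k : ℝ) ^ s = ((k + 1 : ℕ) : ℝ) ^ s * (1 + -((k + 1 : ℕ) : ℝ)⁻¹) ^ s := by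
            rw [← Real.mul_rpow hk.le (by linarith), ← hk_eq]
        _ ≤ ((k + 1 : ℕ) : ℝ) ^ s * (1 + s * -((k + 1 : ℕ) : ℝ)⁻¹) := by
            gcongr
            exact rpow_one_add_le_one_add_mul_self (by linarith) hs.le hs1.le
        _ = _ := by rw [Real.rpow_sub_one hk.ne']; ring
    rw [Finset.sum_range_succ]
    calc _ ≤ (k : ℝ) ^ s / s + ((k + 1 : ℕ) : ℝ) ^ (s - 1) := by gcongr
      _ ≤ (((k + 1 : ℕ) : ℝ) ^ s - s * ((k + 1 : ℕ) : ℝ) ^ (s - 1)) / s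
          + ((k + 1 : ℕ) : ℝ) ^ (s - 1) := by gcongr
      _ = _ := by rw [sub_div, mul_div_cancel_left₀ _ hs.ne', sub_add_cancel]

theorem one_add_sum_rpow_sub_one_isBigO {s : ℝ} (hs : 0 < s) (hs1 : s < 1) :
    (fun k : ℕ => 1 + ∑ i ∈ Finset.range k, (i : ℝ) ^ (s - 1)) =O[atTop]
      fun k : ℕ => (k : ℝ) ^ s := by
  refine IsBigO.add ((natCast_rpow_isBigO_rpow hs.le).congr_left fun k => Real.rpow_zero _)
    (IsBigO.of_bound s⁻¹ (Eventually.of_forall fun k => ?_))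
  rw [Real.norm_of_nonneg (Finset.sum_nonneg fun i _ => by positivity),
    Real.norm_of_nonneg (by positivity), inv_mul_eq_div]
  exact (Finset.sum_le_sum_of_subset_of_nonneg (Finset.range_mono k.le_succ)
    fun i _ _ => by positivity).trans (sum_range_succ_rpow_sub_one_le hs hs1 k)

theorem one_isBigO_log_natCast :
    (fun _ : ℕ => (1 : ℝ)) =O[atTop] fun k : ℕ => Real.log k :=
  (isBigO_const_left_iff_pos_le_norm one_ne_zero).2 ⟨1, one_pos,
    (Real.tendsto_log_atTop.comp tendsto_natCast_atTop_atTop).eventually_ge_atTop 1 |>.mono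
      fun _ hk => hk.trans (Real.le_norm_self _)⟩

theorem one_add_sum_rpow_neg_one_isBigO_log :
    (fun k : ℕ => 1 + ∑ i ∈ Finset.range k, (i : ℝ) ^ (-1 : ℝ)) =O[atTop]
      fun k : ℕ => Real.log k := by
  refine one_isBigO_log_natCast.add (IsBigO.trans
    (IsBigO.of_bound 1 (Eventually.of_forall fun k => ?_))
    (one_isBigO_log_natCast.add (isBigO_refl _ _)))
  have hsum : ∑ i ∈ Finset.range (k + 1), (i : ℝ) ^ (-1 : ℝ) ≤ 1 + Real.log k := by
    refine le_trans (le_of_eq ?_) (harmonic_le_one_add_log k)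
    rw [Finset.sum_range_succ', harmonic]
    push_cast
    simp [Real.rpow_neg_one]
  rw [one_mul, Real.norm_of_nonneg (Finset.sum_nonneg fun i _ => by positivity),
    Real.norm_of_nonneg (add_nonneg zero_le_one (Real.log_natCast_nonneg k))]
  exact (Finset.sum_le_sum_of_subset_of_nonneg (Finset.range_mono k.le_succ)
    fun i _ _ => by positivity).trans hsum

theorem one_add_sum_isBigO_mul {v q g : ℕ → ℝ} {k₁ : ℕ} (hq : ∀ᶠ k in atTop, 1 ≤ q k)
    (hqm : MonotoneOn q (Set.Ici k₁)) (hg : ∀ k, 0 ≤ g k)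
    (hv : v =O[atTop] fun k => q k * g k) :
    (fun k => 1 + ∑ i ∈ Finset.range k, v i) =O[atTop]
      fun k => q k * (1 + ∑ i ∈ Finset.range k, g i) := by
  obtain ⟨c, hc0, hc⟩ := hv.exists_nonneg
  obtain ⟨k₀, hk₀⟩ := eventually_atTop.1 ((hc.bound.and hq).and (eventually_ge_atTop k₁))
  set B := |1 + ∑ i ∈ Finset.range k₀, v i|
  refine IsBigO.of_bound (B + c) (eventually_atTop.2 ⟨k₀, fun k hk => ?_⟩)
  have hqk : 1 ≤ q k := (hk₀ k hk).1.2
  have hterm : ∀ i ∈ Finset.Ico k₀ k, |v i| ≤ c * q k * g i := fun i hi => by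
    obtain ⟨hki, hik⟩ := Finset.mem_Ico.1 hi
    obtain ⟨⟨hvi, hqi⟩, hi₁⟩ := hk₀ i hki
    have : 0 ≤ g i := hg i
    rw [Real.norm_eq_abs, Real.norm_of_nonneg (by positivity), ← mul_assoc] at hvi
    refine hvi.trans ?_
    gcongr
    exact hqm hi₁ (hk₀ k hk).2 hik.le
  have hG : 0 ≤ ∑ i ∈ Finset.range k, g i := Finset.sum_nonneg fun i _ => hg i
  rw [Real.norm_of_nonneg (by positivity : 0 ≤ q k * (1 + ∑ i ∈ Finset.range k, g i)),
    Real.norm_eq_abs, ← Finset.sum_range_add_sum_Ico v hk, ← add_assoc]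
  calc |1 + ∑ i ∈ Finset.range k₀, v i + ∑ i ∈ Finset.Ico k₀ k, v i|
      ≤ B + ∑ i ∈ Finset.Ico k₀ k, |v i| :=
        (abs_add_le _ _).trans (by gcongr; exact Finset.abs_sum_le_sum_abs _ _)
    _ ≤ B + c * q k * ∑ i ∈ Finset.range k, g i := by
        rw [Finset.mul_sum]
        gcongr
        refine (Finset.sum_le_sum hterm).trans (Finset.sum_le_sum_of_subset_of_nonneg ?_ ?_)
        · exact fun i hi => Finset.mem_range.2 (Finset.mem_Ico.1 hi).2
        · intro i _ _
          have : 0 ≤ g i := hg i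
          positivity
    _ ≤ B * (q k * (1 + ∑ i ∈ Finset.range k, g i))
        + c * (q k * (1 + ∑ i ∈ Finset.range k, g i)) := by
        rw [mul_assoc]
        gcongr
        · exact le_mul_of_one_le_right (abs_nonneg _) (one_le_mul_of_one_le_of_one_le hqk
            (le_add_of_nonneg_right hG))
        · exact le_add_of_nonneg_left zero_le_one
    _ = _ := by ring

theorem one_add_sum_rpow_mul_norm_isBigO {V : Type*} [SeminormedAddCommGroup V] {e : ℕ → V}
    {r s : ℝ} (he : e =O[atTop] fun k : ℕ => sqrtLogLog k * (k : ℝ) ^ r) :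
    (fun k : ℕ => 1 + ∑ i ∈ Finset.range k, (i : ℝ) ^ s * ‖e i‖) =O[atTop]
      fun k => sqrtLogLog k * (1 + ∑ i ∈ Finset.range k, (i : ℝ) ^ (s + r)) := by
  refine one_add_sum_isBigO_mul eventually_one_le_sqrtLogLog monotoneOn_sqrtLogLog
    (fun k => by positivity) ?_
  exact ((isBigO_refl _ _).mul he.norm_left).trans (rpow_mul_sqrtLogLog_mul_rpow_isBigO s r)

end Rates

section LinearRecursion

variable {E : Type*} [NormedAddCommGroup E] [InnerProductSpace ℝ E]
  {p e e' z y h : ℕ → E} {a b : ℕ → ℝ} {M A u l κ α δ : ℝ} {N : ℕ}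

theorem norm_sq_sub_inner_smul (b : ℝ) (p v : E) :
    ‖v - (b * inner ℝ p v) • p‖ ^ 2 =
      ‖v‖ ^ 2 - 2 * (b * inner ℝ p v ^ 2) + b ^ 2 * ‖p‖ ^ 2 * inner ℝ p v ^ 2 := by
  rw [norm_sub_sq_real, inner_smul_right, real_inner_comm, norm_smul, mul_pow, Real.norm_eq_abs,
    sq_abs]
  ring

theorem norm_sub_inner_smul_le {b : ℝ} {p : E} (hb : 0 ≤ b) (hbp : b * ‖p‖ ^ 2 ≤ 1) (v : E) :
    ‖v - (b * inner ℝ p v) • p‖ ≤ ‖v‖ := by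
  refine le_of_sq_le_sq ?_ (norm_nonneg _)
  rw [norm_sq_sub_inner_smul]
  have : b * ‖p‖ ^ 2 * (b * inner ℝ p v ^ 2) ≤ 1 * (b * inner ℝ p v ^ 2) := by gcongr
  have : 0 ≤ b * inner ℝ p v ^ 2 := by positivity
  linarith

/-- `z` follows the perturbed gradient recursion with regressors `p`, gains `b` and
perturbations `e`. -/
def IsGradientPath (p : ℕ → E) (b : ℕ → ℝ) (e z : ℕ → E) : Prop :=
  ∀ k, z (k + 1) = z k - (b k * inner ℝ (p k) (z k)) • p k + e k

theorem exists_isGradientPath_zero (p : ℕ → E) (b : ℕ → ℝ) (v : E) :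
    ∃ h, h 0 = v ∧ IsGradientPath p b 0 h :=
  ⟨fun k => Nat.rec v (fun k w => w - (b k * inner ℝ (p k) w) • p k) k, rfl,
    fun _ => (add_zero _).symm⟩

namespace IsGradientPath

theorem shift (hz : IsGradientPath p b e z) (m : ℕ) :
    IsGradientPath (fun j => p (m + j)) (fun j => b (m + j)) (fun j => e (m + j))
      fun j => z (m + j) :=
  fun j => hz (m + j)

theorem sub (hz : IsGradientPath p b e z) (hy : IsGradientPath p b e' y) :
    IsGradientPath p b (e - e') (z - y) := by
  intro k
  simp only [Pi.sub_apply, hz k, hy k, inner_sub_right, mul_sub, sub_smul]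
  abel

theorem norm_le (hz : IsGradientPath p b e z) (hb : ∀ k, 0 ≤ b k)
    (hbp : ∀ k, b k * ‖p k‖ ^ 2 ≤ 1) (n : ℕ) :
    ‖z n‖ ≤ ‖z 0‖ + ∑ j ∈ Finset.range n, ‖e j‖ := by
  induction n with
  | zero => simp
  | succ n ih =>
    rw [hz n, Finset.sum_range_succ, ← add_assoc]
    exact (norm_add_le _ _).trans
      (add_le_add_left ((norm_sub_inner_smul_le (hb n) (hbp n) _).trans ih) _)

end IsGradientPath

theorem mul_norm_sq_le_one {V : Type*} [NormedAddCommGroup V] {b : ℝ} {p : V} (hp : ‖p‖ ≤ M)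
    (hb : b ∈ Set.Icc 0 u) (huM : u * M ^ 2 ≤ 1) : b * ‖p‖ ^ 2 ≤ 1 := by
  have : 0 ≤ u := hb.1.trans hb.2
  refine le_trans ?_ huM
  gcongr
  exact hb.2

theorem abs_inner_le_of_norm_le {p v : E} (hp : ‖p‖ ≤ M) {r : ℝ} (hv : ‖v‖ ≤ r) :
    |inner ℝ p v| ≤ M * r :=
  (abs_real_inner_le_norm p v).trans
    (mul_le_mul hp hv (norm_nonneg v) ((norm_nonneg p).trans hp))

namespace IsGradientPath

theorem norm_le_of_homogeneous (hh : IsGradientPath p b 0 h) (hp : ∀ k, ‖p k‖ ≤ M)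
    (hb : ∀ k, b k ∈ Set.Icc 0 u) (huM : u * M ^ 2 ≤ 1) (n : ℕ) : ‖h n‖ ≤ ‖h 0‖ := by
  simpa using hh.norm_le (fun k => (hb k).1) (fun k => mul_norm_sq_le_one (hp k) (hb k) huM) n

theorem norm_sub_init_le (hh : IsGradientPath p b 0 h) (hp : ∀ k, ‖p k‖ ≤ M)
    (hb : ∀ k, b k ∈ Set.Icc 0 u) (huM : u * M ^ 2 ≤ 1) (n : ℕ) :
    ‖h n - h 0‖ ≤ n * (u * M ^ 2 * ‖h 0‖) := by
  have : 0 ≤ M := (norm_nonneg _).trans (hp 0)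
  have : 0 ≤ u := (hb 0).1.trans (hb 0).2
  induction n with
  | zero => simp
  | succ n ih =>
    have hstep : h (n + 1) - h 0 = (h n - h 0) - (b n * inner ℝ (p n) (h n)) • p n := by
      rw [hh n, Pi.zero_apply, add_zero]; abel
    have hmove : ‖(b n * inner ℝ (p n) (h n)) • p n‖ ≤ u * (M * ‖h 0‖) * M := by
      rw [norm_smul, norm_mul, Real.norm_of_nonneg (hb n).1, Real.norm_eq_abs]
      gcongr
      · exact (hb n).2
      · exact abs_inner_le_of_norm_le (hp n) (hh.norm_le_of_homogeneous hp hb huM n)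
      · exact hp n
    rw [hstep]
    calc _ ≤ n * (u * M ^ 2 * ‖h 0‖) + u * (M * ‖h 0‖) * M :=
          (norm_sub_le _ _).trans (add_le_add ih hmove)
      _ = _ := by push_cast; ring

theorem inner_init_sq_le (hh : IsGradientPath p b 0 h) (hp : ∀ k, ‖p k‖ ≤ M)
    (hb : ∀ k, b k ∈ Set.Icc 0 u) (huM : u * M ^ 2 ≤ 1) (n : ℕ) :
    inner ℝ (p n) (h 0) ^ 2 ≤ inner ℝ (p n) (h n) ^ 2 + 2 * n * M ^ 4 * u * ‖h 0‖ ^ 2 := by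
  have : 0 ≤ M := (norm_nonneg _).trans (hp 0)
  have hsplit : inner ℝ (p n) (h n) = inner ℝ (p n) (h 0) + inner ℝ (p n) (h n - h 0) := by
    rw [← inner_add_right, add_sub_cancel]
  have hcross : |inner ℝ (p n) (h 0) * inner ℝ (p n) (h n - h 0)| ≤
      (M * ‖h 0‖) * (M * (n * (u * M ^ 2 * ‖h 0‖))) := by
    rw [abs_mul]
    exact mul_le_mul (abs_inner_le_of_norm_le (hp n) le_rfl)
      (abs_inner_le_of_norm_le (hp n) (hh.norm_sub_init_le hp hb huM n)) (abs_nonneg _)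
      (by positivity)
  rw [hsplit]
  nlinarith [(abs_le.1 hcross).1, sq_nonneg (inner ℝ (p n) (h n - h 0))]

theorem norm_sq_le_of_homogeneous (hh : IsGradientPath p b 0 h) (hp : ∀ k, ‖p k‖ ≤ M)
    (hb : ∀ k, b k ∈ Set.Icc 0 u) (huM : u * M ^ 2 ≤ 1) (n : ℕ) :
    ‖h n‖ ^ 2 ≤ ‖h 0‖ ^ 2 - 2 * ∑ j ∈ Finset.range n, b j * inner ℝ (p j) (h j) ^ 2 +
      n * (u ^ 2 * M ^ 4 * ‖h 0‖ ^ 2) := by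
  have : 0 ≤ M := (norm_nonneg _).trans (hp 0)
  induction n with
  | zero => simp
  | succ n ih =>
    have hquad : b n ^ 2 * ‖p n‖ ^ 2 * inner ℝ (p n) (h n) ^ 2 ≤ u ^ 2 * M ^ 4 * ‖h 0‖ ^ 2 :=
      calc b n ^ 2 * ‖p n‖ ^ 2 * inner ℝ (p n) (h n) ^ 2
          ≤ u ^ 2 * M ^ 2 * (M * ‖h 0‖) ^ 2 := by
            rw [← sq_abs (inner ℝ (p n) (h n))]
            gcongr
            · exact (hb n).1
            · exact (hb n).2
            · exact hp n
            · exact abs_inner_le_of_norm_le (hp n) (hh.norm_le_of_homogeneous hp hb huM n)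
        _ = _ := by ring
    rw [hh n, Pi.zero_apply, add_zero, norm_sq_sub_inner_smul, Finset.sum_range_succ]
    push_cast
    linarith

theorem norm_le_exp_mul_of_homogeneous (hh : IsGradientPath p b 0 h) (hp : ∀ k, ‖p k‖ ≤ M)
    (hb : ∀ k, b k ∈ Set.Icc 0 u) (huM : u * M ^ 2 ≤ 1) (hl : 0 ≤ l) (hlb : ∀ j < N, l ≤ b j)
    (hlu : l ≤ u) (hexc : κ * ‖h 0‖ ^ 2 ≤ ∑ j ∈ Finset.range N, inner ℝ (p j) (h 0) ^ 2) :
    ‖h N‖ ≤ Real.exp (-(l * κ) + (4 * N ^ 2 + N) * M ^ 4 / 2 * u ^ 2) * ‖h 0‖ := by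
  have : 0 ≤ u := hl.trans hlu
  set c : ℝ := 2 * N * M ^ 4 * u * ‖h 0‖ ^ 2
  have : 0 ≤ c := by positivity
  have hterm : ∀ j ∈ Finset.range N,
      l * inner ℝ (p j) (h 0) ^ 2 - u * c ≤ b j * inner ℝ (p j) (h j) ^ 2 := fun j hj => by
    have hjN : j < N := Finset.mem_range.1 hj
    have hinner : inner ℝ (p j) (h 0) ^ 2 ≤ inner ℝ (p j) (h j) ^ 2 + c :=
      (hh.inner_init_sq_le hp hb huM j).trans (by dsimp only [c]; gcongr)
    calc _ ≤ l * (inner ℝ (p j) (h j) ^ 2 + c) - l * c := by gcongr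
      _ = l * inner ℝ (p j) (h j) ^ 2 := by ring
      _ ≤ _ := by gcongr; exact hlb j hjN
  have hsum : l * (κ * ‖h 0‖ ^ 2) - N * (u * c) ≤
      ∑ j ∈ Finset.range N, b j * inner ℝ (p j) (h j) ^ 2 := by
    refine le_trans ?_ (Finset.sum_le_sum hterm)
    rw [Finset.sum_sub_distrib, ← Finset.mul_sum, Finset.sum_const, Finset.card_range,
      nsmul_eq_mul]
    gcongr
  set q : ℝ := -(l * κ) + (4 * N ^ 2 + N) * M ^ 4 / 2 * u ^ 2 with hq
  refine le_of_sq_le_sq ?_ (by positivity)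
  calc ‖h N‖ ^ 2 ≤ ‖h 0‖ ^ 2 - 2 * (l * (κ * ‖h 0‖ ^ 2) - N * (u * c)) +
          N * (u ^ 2 * M ^ 4 * ‖h 0‖ ^ 2) :=
        (hh.norm_sq_le_of_homogeneous hp hb huM N).trans (by gcongr)
    _ = (2 * q + 1) * ‖h 0‖ ^ 2 := by rw [hq]; ring
    _ ≤ Real.exp (2 * q) * ‖h 0‖ ^ 2 := by gcongr; exact Real.add_one_le_exp _
    _ = (Real.exp q * ‖h 0‖) ^ 2 := by rw [two_mul, Real.exp_add]; ring

theorem norm_le_exp_mul_add_sum (hz : IsGradientPath p b e z) (hp : ∀ k, ‖p k‖ ≤ M)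
    (hb : ∀ k, b k ∈ Set.Icc 0 u) (huM : u * M ^ 2 ≤ 1) (hl : 0 ≤ l) (hlb : ∀ j < N, l ≤ b j)
    (hlu : l ≤ u) (hexc : κ * ‖z 0‖ ^ 2 ≤ ∑ j ∈ Finset.range N, inner ℝ (p j) (z 0) ^ 2) :
    ‖z N‖ ≤ Real.exp (-(l * κ) + (4 * N ^ 2 + N) * M ^ 4 / 2 * u ^ 2) * ‖z 0‖ +
      ∑ j ∈ Finset.range N, ‖e j‖ := by
  obtain ⟨h, h_init, hh⟩ := exists_isGradientPath_zero p b (z 0)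
  have hhom := hh.norm_le_exp_mul_of_homogeneous hp hb huM hl hlb hlu (h_init ▸ hexc)
  have hdiff := (hz.sub hh).norm_le (fun k => (hb k).1)
    (fun k => mul_norm_sq_le_one (hp k) (hb k) huM) N
  rw [h_init] at hhom
  simp only [Pi.sub_apply, h_init, sub_self, norm_zero, zero_add, sub_zero, Pi.zero_apply]
    at hdiff
  exact (norm_le_insert' _ _).trans (add_le_add hhom hdiff)

theorem exists_norm_le (hz : IsGradientPath p (fun k => a k / (k + 1)) e z)
    (hp : ∀ k, ‖p k‖ ≤ M) (ha : ∀ k, a k ∈ Set.Icc 0 A) (he : Summable fun k => ‖e k‖) :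
    ∃ R, ∀ k, ‖z k‖ ≤ R := by
  have : 0 ≤ A := (ha 0).1.trans (ha 0).2
  obtain ⟨m, hm⟩ := exists_nat_ge (A * M ^ 2)
  have hgain : ∀ j : ℕ, a (m + j) / ((m + j : ℕ) + 1) ∈ Set.Icc 0 (A / (m + 1)) := fun j => by
    refine ⟨div_nonneg (ha _).1 (by positivity), ?_⟩
    push_cast
    gcongr
    · exact (ha _).2
    · linarith [(Nat.cast_nonneg j : (0 : ℝ) ≤ j)]
  have hsmall : A / (m + 1) * M ^ 2 ≤ 1 := by
    rw [div_mul_eq_mul_div, div_le_one (by positivity)]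
    linarith
  have hbound := (hz.shift m).norm_le (fun j => (hgain j).1)
    fun j => mul_norm_sq_le_one (hp _) (hgain j) hsmall
  have hev : IsBoundedUnder (· ≤ ·) atTop fun k => ‖z k‖ :=
    isBoundedUnder_of_eventually_le (a := ‖z m‖ + ∑' j, ‖e (m + j)‖) <|
      eventually_atTop.2 ⟨m, fun k hk => by
        obtain ⟨j, rfl⟩ := Nat.exists_eq_add_of_le hk
        refine (hbound j).trans (add_le_add_right ?_ _)
        exact (he.comp_injective (add_right_injective m)).sum_le_tsum _ fun _ _ => norm_nonneg _⟩
  obtain ⟨R, hR⟩ := hev.bddAbove_range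
  exact ⟨R, fun k => hR (Set.mem_range_self k)⟩

end IsGradientPath

/-- Persistently exciting regressors: they are bounded by `M`, and the average of `p pᵀ` over any
window of length `N` is at least `δ`, expressed through the quadratic form. -/
structure IsExciting (p : ℕ → E) (M δ : ℝ) (N : ℕ) : Prop where
  window_pos : 0 < N
  delta_pos : 0 < δ
  norm_le : ∀ k, ‖p k‖ ≤ M
  exciting : ∀ k v, N * δ * ‖v‖ ^ 2 ≤ ∑ i ∈ Finset.range N, inner ℝ (p (k + i)) v ^ 2

theorem rpow_add_natCast_le_mul_exp {s : ℝ} (hs : 0 ≤ s) {m : ℕ} (hm : 0 < m) (N : ℕ) :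
    ((m + N : ℕ) : ℝ) ^ s ≤ (m : ℝ) ^ s * Real.exp (s * (N / m)) := by
  have hm' : (0 : ℝ) < m := Nat.cast_pos.2 hm
  have hle : ((m + N : ℕ) : ℝ) ≤ m * Real.exp (N / m) :=
    calc ((m + N : ℕ) : ℝ) = m * (N / m + 1) := by
          rw [mul_add, mul_div_cancel₀ _ hm'.ne', mul_one, add_comm, Nat.cast_add]
      _ ≤ _ := by gcongr; exact Real.add_one_le_exp _
  calc ((m + N : ℕ) : ℝ) ^ s ≤ (m * Real.exp (N / m)) ^ s := by gcongr
    _ = _ := by rw [Real.mul_rpow hm'.le (Real.exp_pos _).le, ← Real.exp_mul, mul_comm s]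

theorem rpow_add_natCast_le_mul_rpow {s : ℝ} (hs : 0 ≤ s) {m : ℕ} (hm : 0 < m) (N j : ℕ) :
    ((m + N : ℕ) : ℝ) ^ s ≤ (1 + N : ℝ) ^ s * ((m + j : ℕ) : ℝ) ^ s := by
  rw [← Real.mul_rpow (by positivity) (by positivity)]
  gcongr
  have hle : m + N ≤ (1 + N) * (m + j) := by nlinarith
  exact_mod_cast hle

theorem div_sub_div_add_natCast_le {m : ℕ} (hm : 0 < m) (N : ℕ) :
    (N : ℝ) / m - N / (m + N : ℕ) ≤ N ^ 2 / (m : ℝ) ^ 2 := by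
  have : (0 : ℝ) < m := Nat.cast_pos.2 hm
  calc (N : ℝ) / m - N / (m + N : ℕ) = N ^ 2 / (m * (m + N : ℕ)) := by
        field_simp; push_cast; ring
    _ ≤ N ^ 2 / ((m : ℝ) * m) := by
        gcongr
        exact Nat.le_add_right m N
    _ = _ := by rw [sq (m : ℝ)]

theorem weighted_window_exponent_le (hαδ : 0 ≤ α * δ) (c A : ℝ) {m : ℕ} (hm : 0 < m) (N : ℕ) :
    α * δ * (N / m) + (-(α / (m + N : ℕ) * (N * δ)) + c * (A / m) ^ 2) ≤
      (α * δ * N ^ 2 + c * A ^ 2) * (1 / (m : ℝ) ^ 2) :=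
  calc _ = α * δ * ((N : ℝ) / m - N / (m + N : ℕ)) + c * (A / m) ^ 2 := by ring
    _ ≤ α * δ * (N ^ 2 / (m : ℝ) ^ 2) + c * (A / m) ^ 2 := by
        gcongr; exact div_sub_div_add_natCast_le hm N
    _ = _ := by ring

-- The weight gains a factor `(1 + N / m) ^ (α δ) ≈ exp (α δ N / m)` over a window, which cancels
-- the contraction factor up to the summable order `1 / m²`.
theorem IsGradientPath.rpow_mul_norm_window_le
    (hz : IsGradientPath p (fun k => a k / (k + 1)) e z) (hp : IsExciting p M δ N) (hα : 0 < α)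
    {m : ℕ} (hm : 0 < m) (hmA : A * M ^ 2 ≤ m) (ha : ∀ j, a (m + j) ∈ Set.Icc α A) :
    ((m + N : ℕ) : ℝ) ^ (α * δ) * ‖z (m + N)‖ ≤
      Real.exp ((α * δ * N ^ 2 + (4 * N ^ 2 + N) * M ^ 4 / 2 * A ^ 2) * (1 / (m : ℝ) ^ 2)) *
        ((m : ℝ) ^ (α * δ) * ‖z m‖) +
      ∑ j ∈ Finset.range N,
        (1 + N : ℝ) ^ (α * δ) * (((m + j : ℕ) : ℝ) ^ (α * δ) * ‖e (m + j)‖) := by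
  have hm' : (0 : ℝ) < m := Nat.cast_pos.2 hm
  have : 0 < δ := hp.delta_pos
  have hαA : α ≤ A := (ha 0).1.trans (ha 0).2
  have : 0 ≤ A := hα.le.trans hαA
  have hgain : ∀ j : ℕ, a (m + j) / ((m + j : ℕ) + 1) ∈ Set.Icc 0 (A / m) := fun j => by
    refine ⟨div_nonneg (hα.le.trans (ha j).1) (by positivity), ?_⟩
    push_cast
    gcongr
    · exact (ha j).2
    · linarith [(Nat.cast_nonneg j : (0 : ℝ) ≤ j)]
  have hgain_lower : ∀ j < N, α / (m + N : ℕ) ≤ a (m + j) / ((m + j : ℕ) + 1) := fun j hj => by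
    have : 0 ≤ a (m + j) := hα.le.trans (ha j).1
    gcongr
    · exact (ha j).1
    · exact_mod_cast (by omega : m + j + 1 ≤ m + N)
  have hwindow := (hz.shift m).norm_le_exp_mul_add_sum (l := α / (m + N : ℕ)) (u := A / m)
    (κ := N * δ) (fun j => hp.norm_le _) hgain
    (by rw [div_mul_eq_mul_div]; exact (div_le_one hm').2 hmA) (by positivity) hgain_lower
    (by gcongr; exact Nat.le_add_right m N) (hp.exciting m (z m))
  refine (mul_le_mul_of_nonneg_left hwindow (by positivity)).trans ?_
  rw [mul_add, Finset.mul_sum]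
  refine add_le_add ?_ (Finset.sum_le_sum fun j _ => ?_)
  · rw [add_zero]
    refine (mul_le_mul_of_nonneg_right (rpow_add_natCast_le_mul_exp (by positivity) hm N)
      (by positivity)).trans ?_
    rw [mul_comm (_ ^ _) (Real.exp _), mul_mul_mul_comm, ← Real.exp_add]
    gcongr
    exact weighted_window_exponent_le (by positivity) _ A hm N
  · rw [← mul_assoc]
    gcongr
    exact rpow_add_natCast_le_mul_rpow (by positivity) hm N j

theorem le_exp_sum_mul_add_sum_of_le_exp_mul_add {u v ε : ℕ → ℝ} {N m₀ : ℕ} {B : ℝ} (hN : 0 < N)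
    (hv : ∀ k, 0 ≤ v k) (hε : ∀ k, 0 ≤ ε k) (hB : 0 ≤ B) (huB : ∀ k < m₀ + N, u k ≤ B)
    (h : ∀ m ≥ m₀, u (m + N) ≤ Real.exp (ε m) * u m + ∑ j ∈ Finset.range N, v (m + j)) (k : ℕ) :
    u k ≤ Real.exp (∑ i ∈ Finset.range k, ε i) * (B + ∑ i ∈ Finset.range k, v i) := by
  have hBV : ∀ k, 0 ≤ B + ∑ i ∈ Finset.range k, v i := fun k =>
    add_nonneg hB (Finset.sum_nonneg fun i _ => hv i)
  have hexp_one : ∀ k, 1 ≤ Real.exp (∑ i ∈ Finset.range k, ε i) := fun k =>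
    Real.one_le_exp (Finset.sum_nonneg fun i _ => hε i)
  induction k using Nat.strong_induction_on with
  | _ k ih =>
    rcases lt_or_ge k (m₀ + N) with hlt | hge
    · calc u k ≤ B := huB k hlt
        _ ≤ B + ∑ i ∈ Finset.range k, v i :=
          le_add_of_nonneg_right (Finset.sum_nonneg fun i _ => hv i)
        _ ≤ _ := le_mul_of_one_le_left (hBV k) (hexp_one k)
    · obtain ⟨m, rfl⟩ : ∃ m, k = m + N := ⟨k - N, by omega⟩
      have hexp : Real.exp (ε m) * Real.exp (∑ i ∈ Finset.range m, ε i) ≤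
          Real.exp (∑ i ∈ Finset.range (m + N), ε i) := by
        rw [← Real.exp_add, add_comm, ← Finset.sum_range_succ, Real.exp_le_exp]
        exact Finset.sum_le_sum_of_subset_of_nonneg (Finset.range_mono (by omega))
          fun i _ _ => hε i
      have hW : 0 ≤ ∑ j ∈ Finset.range N, v (m + j) := Finset.sum_nonneg fun j _ => hv _
      calc u (m + N) ≤ Real.exp (ε m) * (Real.exp (∑ i ∈ Finset.range m, ε i) *
            (B + ∑ i ∈ Finset.range m, v i)) + ∑ j ∈ Finset.range N, v (m + j) := by
            refine (h m (by omega)).trans ?_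
            gcongr
            exact ih m (by omega)
        _ ≤ Real.exp (∑ i ∈ Finset.range (m + N), ε i) * (B + ∑ i ∈ Finset.range m, v i) +
            Real.exp (∑ i ∈ Finset.range (m + N), ε i) * ∑ j ∈ Finset.range N, v (m + j) := by
            rw [← mul_assoc]
            exact add_le_add (mul_le_mul_of_nonneg_right hexp (hBV m))
              (le_mul_of_one_le_left hW (hexp_one _))
        _ = _ := by rw [Finset.sum_range_add v, ← mul_add, add_assoc]

theorem exists_le_mul_one_add_sum_of_le_exp_mul_add {u v ε : ℕ → ℝ} {N m₀ : ℕ} (hN : 0 < N)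
    (hu : ∀ k, 0 ≤ u k) (hv : ∀ k, 0 ≤ v k) (hε : ∀ k, 0 ≤ ε k) (hε_sum : Summable ε)
    (h : ∀ m ≥ m₀, u (m + N) ≤ Real.exp (ε m) * u m + ∑ j ∈ Finset.range N, v (m + j)) :
    ∃ D, 0 ≤ D ∧ ∀ k, u k ≤ D * (1 + ∑ i ∈ Finset.range k, v i) := by
  set B := ∑ k ∈ Finset.range (m₀ + N), u k
  have hB : 0 ≤ B := Finset.sum_nonneg fun k _ => hu k
  have huB : ∀ k < m₀ + N, u k ≤ B := fun k hk =>
    Finset.single_le_sum (fun i _ => hu i) (Finset.mem_range.2 hk)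
  refine ⟨Real.exp (∑' i, ε i) * (B + 1), by positivity, fun k =>
    (le_exp_sum_mul_add_sum_of_le_exp_mul_add hN hv hε hB huB h k).trans ?_⟩
  have hV : 0 ≤ ∑ i ∈ Finset.range k, v i := Finset.sum_nonneg fun i _ => hv i
  have hBV : B + ∑ i ∈ Finset.range k, v i ≤ (B + 1) * (1 + ∑ i ∈ Finset.range k, v i) := by
    linarith [mul_nonneg hB hV]
  rw [mul_assoc]
  exact mul_le_mul (Real.exp_le_exp.2 (hε_sum.sum_le_tsum _ fun i _ => hε i)) hBV
    (add_nonneg hB hV) (Real.exp_pos _).le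

end LinearRecursion

section Decay

variable {E : Type*} [NormedAddCommGroup E] [InnerProductSpace ℝ E]
  {p e z : ℕ → E} {a : ℕ → ℝ} {M A α δ : ℝ} {N : ℕ}

namespace IsGradientPath

theorem exists_rpow_mul_norm_le (hz : IsGradientPath p (fun k => a k / (k + 1)) e z)
    (hp : IsExciting p M δ N) (hα : 0 < α) (ha : ∀ᶠ k in atTop, a k ∈ Set.Icc α A) :
    ∃ D, 0 ≤ D ∧ ∀ k : ℕ, (k : ℝ) ^ (α * δ) * ‖z k‖ ≤
      D * (1 + ∑ i ∈ Finset.range k, (i : ℝ) ^ (α * δ) * ‖e i‖) := by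
  have : 0 < δ := hp.delta_pos
  have hlarge : ∀ᶠ m : ℕ in atTop, A * M ^ 2 ≤ m :=
    tendsto_natCast_atTop_atTop.eventually_ge_atTop _
  obtain ⟨m₀, hm₀⟩ := eventually_atTop.1 (ha.and (hlarge.and (eventually_gt_atTop 0)))
  set L : ℝ := (1 + N : ℝ) ^ (α * δ)
  have hL : 1 ≤ L := Real.one_le_rpow (by linarith [(Nat.cast_nonneg N : (0 : ℝ) ≤ N)])
    (by positivity)
  obtain ⟨D, hD, hle⟩ := exists_le_mul_one_add_sum_of_le_exp_mul_add hp.window_pos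
    (u := fun k : ℕ => (k : ℝ) ^ (α * δ) * ‖z k‖)
    (v := fun k : ℕ => L * ((k : ℝ) ^ (α * δ) * ‖e k‖))
    (fun k => by positivity) (fun k => by positivity) (fun k => by positivity)
    ((Real.summable_one_div_nat_pow.2 one_lt_two).mul_left
      (α * δ * N ^ 2 + (4 * N ^ 2 + N) * M ^ 4 / 2 * A ^ 2))
    fun m hm => hz.rpow_mul_norm_window_le hp hα (hm₀ m hm).2.2 (hm₀ m hm).2.1
      fun j => (hm₀ (m + j) (hm.trans (Nat.le_add_right m j))).1
  refine ⟨D * L, by positivity, fun k => (hle k).trans ?_⟩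
  rw [mul_assoc, ← Finset.mul_sum, mul_add L, mul_one]
  gcongr

theorem isBigO_rpow_neg_mul (hz : IsGradientPath p (fun k => a k / (k + 1)) e z)
    (hp : IsExciting p M δ N) (hα : 0 < α) (ha : ∀ᶠ k in atTop, a k ∈ Set.Icc α A) {g : ℕ → ℝ}
    (hg : (fun k => 1 + ∑ i ∈ Finset.range k, (i : ℝ) ^ (α * δ) * ‖e i‖) =O[atTop] g) :
    z =O[atTop] fun k : ℕ => (k : ℝ) ^ (-(α * δ)) * g k := by
  obtain ⟨D, _, hle⟩ := hz.exists_rpow_mul_norm_le hp hα ha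
  refine IsBigO.trans (IsBigO.of_bound D ?_) ((isBigO_refl _ _).mul hg)
  filter_upwards [eventually_gt_atTop 0] with k hk
  have hk' : (0 : ℝ) < k := Nat.cast_pos.2 hk
  have : 0 ≤ ∑ i ∈ Finset.range k, (i : ℝ) ^ (α * δ) * ‖e i‖ :=
    Finset.sum_nonneg fun i _ => by positivity
  rw [Real.norm_of_nonneg (by positivity), mul_left_comm, Real.rpow_neg hk'.le,
    ← div_eq_inv_mul, le_div_iff₀ (by positivity), mul_comm]
  exact hle k

theorem isBigO_rpow_neg_of_summable (hz : IsGradientPath p (fun k => a k / (k + 1)) e z)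
    (hp : IsExciting p M δ N) (hα : 0 < α) (ha : ∀ᶠ k in atTop, a k ∈ Set.Icc α A)
    (he : Summable fun k : ℕ => (k : ℝ) ^ (α * δ) * ‖e k‖) :
    z =O[atTop] fun k : ℕ => (k : ℝ) ^ (-(α * δ)) := by
  refine (hz.isBigO_rpow_neg_mul hp hα ha (g := fun _ => 1) ?_).congr_right fun k => mul_one _
  exact (tendsto_const_nhds.add he.hasSum.tendsto_sum_nat).isBigO_one ℝ

theorem isBigO_log_mul_sqrtLogLog_mul_rpow
    (hz : IsGradientPath p (fun k => a k / (k + 1)) e z) (hp : IsExciting p M δ N) (hα : 0 < α)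
    (ha : ∀ᶠ k in atTop, a k ∈ Set.Icc α A) (hαδ : α * δ = 1 / 2)
    (he : e =O[atTop] fun k : ℕ => sqrtLogLog k * (k : ℝ) ^ (-(3 / 2) : ℝ)) :
    z =O[atTop] fun k : ℕ => Real.log k * (sqrtLogLog k * (k : ℝ) ^ (-(1 / 2) : ℝ)) := by
  have hsum := one_add_sum_rpow_mul_norm_isBigO (s := α * δ) he
  rw [hαδ, show (1 / 2 + -(3 / 2) : ℝ) = -1 by norm_num] at hsum
  have hg := hsum.trans ((isBigO_refl _ _).mul one_add_sum_rpow_neg_one_isBigO_log)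
  rw [← hαδ] at hg
  refine (hz.isBigO_rpow_neg_mul hp hα ha hg).congr_right fun k => ?_
  rw [hαδ]
  ring

theorem isBigO_sqrtLogLog_mul_rpow
    (hz : IsGradientPath p (fun k => a k / (k + 1)) e z) (hp : IsExciting p M δ N) (hα : 0 < α)
    (ha : ∀ᶠ k in atTop, a k ∈ Set.Icc α A) (hαδ : 1 / 2 < α * δ) (hαδ' : α * δ < 3 / 2)
    (he : e =O[atTop] fun k : ℕ => sqrtLogLog k * (k : ℝ) ^ (-(3 / 2) : ℝ)) :
    z =O[atTop] fun k : ℕ => sqrtLogLog k * (k : ℝ) ^ (-(1 / 2) : ℝ) := by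
  have hpow := one_add_sum_rpow_sub_one_isBigO (s := α * δ - 1 / 2) (by linarith) (by linarith)
  rw [show α * δ - 1 / 2 - 1 = α * δ + -(3 / 2) by ring] at hpow
  refine (hz.isBigO_rpow_neg_mul hp hα ha
    ((one_add_sum_rpow_mul_norm_isBigO he).trans ((isBigO_refl _ _).mul hpow))).trans ?_
  refine (rpow_mul_sqrtLogLog_mul_rpow_isBigO (-(α * δ)) (α * δ - 1 / 2)).congr_right fun k => ?_
  ring_nf

end IsGradientPath

end Decay

theorem max_sub_isBigO_rpow_neg {V : Type*} [SeminormedAddCommGroup V] {x : ℕ → V} {a : ℕ → ℝ}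
    {L lam s : ℝ} (hL : ∀ r > 0, r ≤ 1 → ∀ k, ‖x k‖ ≤ r → lam - L * r ≤ a k) (hs : 0 < s)
    (hx : x =O[atTop] fun k : ℕ => (k : ℝ) ^ (-s)) :
    (fun k => max (a k) lam - a k) =O[atTop] fun k : ℕ => (k : ℝ) ^ (-s) := by
  obtain ⟨c, hc, hxc⟩ := hx.exists_pos
  have hr_tendsto : Tendsto (fun k : ℕ => c * (k : ℝ) ^ (-s)) atTop (𝓝 (c * 0)) :=
    ((tendsto_rpow_neg_atTop hs).comp tendsto_natCast_atTop_atTop).const_mul c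
  refine IsBigO.of_bound (|L| * c) ?_
  filter_upwards [hxc.bound, hr_tendsto.eventually_le_const (by simp : c * 0 < 1),
    eventually_gt_atTop 0] with k hxk hr hk
  have : (0 : ℝ) < k := Nat.cast_pos.2 hk
  rw [Real.norm_of_nonneg (by positivity : 0 ≤ (k : ℝ) ^ (-s))] at hxk ⊢
  rw [Real.norm_of_nonneg (sub_nonneg.2 (le_max_left _ _)), ← max_sub_sub_right, sub_self,
    mul_assoc]
  refine max_le (by positivity) ?_
  calc lam - a k ≤ L * (c * (k : ℝ) ^ (-s)) := by linarith [hL _ (by positivity) hr k hxk]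
    _ ≤ |L| * (c * (k : ℝ) ^ (-s)) := by gcongr; exact le_abs_self L

section ErrorRecursion

variable {E : Type*} [NormedAddCommGroup E] [InnerProductSpace ℝ E]
  {p x ξ e v z : ℕ → E} {a b b' c : ℕ → ℝ} {M A L δ lam s : ℝ} {N : ℕ}

theorem inv_natCast_add_one_isBigO :
    (fun k : ℕ => ((k : ℝ) + 1)⁻¹) =O[atTop] fun k : ℕ => (k : ℝ) ^ (-1 : ℝ) := by
  refine IsBigO.of_bound 1 ?_
  filter_upwards [eventually_gt_atTop 0] with k hk
  have : (0 : ℝ) < k := Nat.cast_pos.2 hk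
  rw [one_mul, Real.rpow_neg_one, Real.norm_of_nonneg (by positivity),
    Real.norm_of_nonneg (by positivity)]
  gcongr
  linarith

theorem smul_inner_smul_isBigO (hp : ∀ k, ‖p k‖ ≤ M) (c : ℕ → ℝ) (v : ℕ → E) :
    (fun k => (c k * inner ℝ (p k) (v k)) • p k) =O[atTop] fun k => c k * ‖v k‖ := by
  refine IsBigO.of_bound (M * M) (Eventually.of_forall fun k => ?_)
  have hinner : |inner ℝ (p k) (v k)| ≤ M * ‖v k‖ := abs_inner_le_of_norm_le (hp k) le_rfl
  have : 0 ≤ M := (norm_nonneg _).trans (hp k)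
  rw [norm_smul, norm_mul, norm_mul, norm_norm, Real.norm_eq_abs (inner ℝ _ _)]
  calc ‖c k‖ * |inner ℝ (p k) (v k)| * ‖p k‖ ≤ ‖c k‖ * (M * ‖v k‖) * M := by
        gcongr
        exact hp k
    _ = _ := by ring

theorem IsGradientPath.change_gain (hz : IsGradientPath p b e z) (b' : ℕ → ℝ) :
    IsGradientPath p b' (fun k => e k + ((b' k - b k) * inner ℝ (p k) (z k)) • p k) z := by
  intro k
  rw [hz k]
  module

/-- The mean of the first `k` terms of the sequence `ξ`, which is `0` for `k = 0`. The running
mean of the noise is subtracted from the error path to leave smaller perturbations. -/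
noncomputable def runningMean (ξ : ℕ → E) (k : ℕ) : E :=
  (k : ℝ)⁻¹ • ∑ i ∈ Finset.range k, ξ i

theorem runningMean_succ (ξ : ℕ → E) (k : ℕ) :
    runningMean ξ (k + 1) =
      runningMean ξ k + ((k : ℝ) + 1)⁻¹ • (ξ k - runningMean ξ k) := by
  have hsum : ∑ i ∈ Finset.range k, ξ i = (k : ℝ) • runningMean ξ k := by
    rcases k.eq_zero_or_pos with rfl | hk
    · simp
    · rw [runningMean, smul_inv_smul₀ (Nat.cast_pos.2 hk).ne']
  have hk : (k : ℝ) + 1 ≠ 0 := by positivity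
  rw [runningMean, Finset.sum_range_succ, hsum, Nat.cast_succ, inv_smul_eq_iff₀ hk, smul_add,
    smul_inv_smul₀ hk]
  module

theorem runningMean_isBigO (hξ : (fun k => ∑ i ∈ Finset.range k, ξ i) =O[atTop]
      fun k : ℕ => sqrtLogLog k * (k : ℝ) ^ (1 / 2 : ℝ)) :
    runningMean ξ =O[atTop] fun k : ℕ => sqrtLogLog k * (k : ℝ) ^ (-(1 / 2) : ℝ) := by
  have hinv : (fun k : ℕ => (k : ℝ)⁻¹) =O[atTop] fun k : ℕ => (k : ℝ) ^ (-1 : ℝ) :=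
    (isBigO_refl _ _).congr_left fun k => Real.rpow_neg_one _
  have hrate := rpow_mul_sqrtLogLog_mul_rpow_isBigO (-1) (1 / 2)
  rw [show (-1 + 1 / 2 : ℝ) = -(1 / 2) by norm_num] at hrate
  exact (hinv.smul hξ).trans hrate

theorem IsGradientPath.sub_runningMean
    (hx : IsGradientPath p (fun k => a k / (k + 1)) (fun k => ((k : ℝ) + 1)⁻¹ • ξ k) x) :
    IsGradientPath p (fun k => a k / (k + 1))
      (fun k => ((k : ℝ) + 1)⁻¹ •
        (runningMean ξ k - (a k * inner ℝ (p k) (runningMean ξ k)) • p k))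
      (x - runningMean ξ) := by
  intro k
  rw [Pi.sub_apply, Pi.sub_apply, hx k, runningMean_succ, inner_sub_right]
  module

theorem inv_smul_sub_smul_inner_smul_isBigO (hp : ∀ k, ‖p k‖ ≤ M) (ha : ∀ k, a k ∈ Set.Icc 0 A)
    (hv : v =O[atTop] fun k : ℕ => sqrtLogLog k * (k : ℝ) ^ (-(1 / 2) : ℝ)) :
    (fun k : ℕ => ((k : ℝ) + 1)⁻¹ • (v k - (a k * inner ℝ (p k) (v k)) • p k)) =O[atTop]
      fun k : ℕ => sqrtLogLog k * (k : ℝ) ^ (-(3 / 2) : ℝ) := by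
  have ha_bdd : a =O[atTop] fun _ : ℕ => (1 : ℝ) := IsBigO.of_bound A (Eventually.of_forall
    fun k => by rw [norm_one, mul_one, Real.norm_of_nonneg (ha k).1]; exact (ha k).2)
  have hgain : (fun k => (a k * inner ℝ (p k) (v k)) • p k) =O[atTop] v :=
    (smul_inner_smul_isBigO hp a v).trans ((ha_bdd.mul (isBigO_refl _ _)).congr_right
      fun k => one_mul ‖v k‖).of_norm_right
  have hrate := rpow_mul_sqrtLogLog_mul_rpow_isBigO (-1) (-(1 / 2))
  rw [show (-1 + -(1 / 2) : ℝ) = -(3 / 2) by norm_num] at hrate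
  exact (inv_natCast_add_one_isBigO.smul (((isBigO_refl v _).sub hgain).trans hv)).trans hrate

/-- The error recursion of a stochastic gradient algorithm: a gradient path `x` with step sizes
`a k / (k + 1)`, driven by noise `ξ` that obeys the bound of the law of the iterated logarithm.
The gains `a` depend on the state: they are bounded away from `0` while `x` is bounded, and
asymptotically at least `lam` when `x` tends to `0`. -/
structure ErrorRecursion (p x ξ : ℕ → E) (a : ℕ → ℝ) (A lam : ℝ) : Prop where
  path : IsGradientPath p (fun k => a k / (k + 1)) (fun k => ((k : ℝ) + 1)⁻¹ • ξ k) x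
  noise : (fun k => ∑ i ∈ Finset.range k, ξ i) =O[atTop]
    fun k : ℕ => sqrtLogLog k * (k : ℝ) ^ (1 / 2 : ℝ)
  gain_le : ∀ k, a k ≤ A
  exists_pos_le_gain : ∀ R, ∃ α > 0, ∀ k, ‖x k‖ ≤ R → α ≤ a k
  exists_le_gain : ∀ α < lam, ∃ r > 0, ∀ k, ‖x k‖ ≤ r → α ≤ a k
  limit_pos : 0 < lam

namespace ErrorRecursion

theorem gain_mem_Icc (h : ErrorRecursion p x ξ a A lam) (k : ℕ) : a k ∈ Set.Icc 0 A := by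
  obtain ⟨α, hα, hle⟩ := h.exists_pos_le_gain ‖x k‖
  exact ⟨hα.le.trans (hle k le_rfl), h.gain_le k⟩

theorem exists_isGradientPath_sub_runningMean (h : ErrorRecursion p x ξ a A lam)
    (hp : ∀ k, ‖p k‖ ≤ M) :
    ∃ e, IsGradientPath p (fun k => a k / (k + 1)) e (x - runningMean ξ) ∧
      e =O[atTop] fun k : ℕ => sqrtLogLog k * (k : ℝ) ^ (-(3 / 2) : ℝ) :=
  ⟨_, h.path.sub_runningMean,
    inv_smul_sub_smul_inner_smul_isBigO hp h.gain_mem_Icc (runningMean_isBigO h.noise)⟩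

theorem isBigO_of_sub_runningMean (h : ErrorRecursion p x ξ a A lam) {g : ℕ → ℝ}
    (hg : (fun k : ℕ => sqrtLogLog k * (k : ℝ) ^ (-(1 / 2) : ℝ)) =O[atTop] g)
    (hz : (x - runningMean ξ) =O[atTop] g) : x =O[atTop] g :=
  (hz.add ((runningMean_isBigO h.noise).trans hg)).congr_left fun _ => sub_add_cancel _ _

theorem isBigO_rpow_neg_of_eventually_le (h : ErrorRecursion p x ξ a A lam)
    (hp : IsExciting p M δ N) {α : ℝ} (hα : 0 < α) (hαδ : α * δ < 1 / 2)
    (ha : ∀ᶠ k in atTop, α ≤ a k) : x =O[atTop] fun k : ℕ => (k : ℝ) ^ (-(α * δ)) := by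
  obtain ⟨e, hz, he⟩ := h.exists_isGradientPath_sub_runningMean hp.norm_le
  exact h.isBigO_of_sub_runningMean (sqrtLogLog_mul_rpow_isBigO_rpow (neg_lt_neg hαδ))
    (hz.isBigO_rpow_neg_of_summable hp hα (ha.mono fun k hk => ⟨hk, h.gain_le k⟩)
      (summable_rpow_mul_norm_of_isBigO (by linarith) he))

theorem exists_eventually_norm_le (h : ErrorRecursion p x ξ a A lam) (hp : ∀ k, ‖p k‖ ≤ M) :
    ∃ R, ∀ᶠ k in atTop, ‖x k‖ ≤ R := by
  obtain ⟨e, hz, he⟩ := h.exists_isGradientPath_sub_runningMean hp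
  obtain ⟨R, hR⟩ := hz.exists_norm_le hp h.gain_mem_Icc
    (by simpa using summable_rpow_mul_norm_of_isBigO (s := 0) (by norm_num) he)
  have hbdd : x =O[atTop] fun k : ℕ => (k : ℝ) ^ (0 : ℝ) := by
    refine h.isBigO_of_sub_runningMean (sqrtLogLog_mul_rpow_isBigO_rpow (by norm_num)) ?_
    exact IsBigO.of_bound R (Eventually.of_forall fun k => by simpa using hR k)
  obtain ⟨B, hB⟩ := hbdd.bound
  exact ⟨B, hB.mono fun k hk => by simpa using hk⟩

theorem tendsto_zero (h : ErrorRecursion p x ξ a A lam) (hp : IsExciting p M δ N) :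
    Tendsto x atTop (𝓝 0) := by
  have hδ : 0 < δ := hp.delta_pos
  obtain ⟨R, hR⟩ := h.exists_eventually_norm_le hp.norm_le
  obtain ⟨α₀, hα₀, hle⟩ := h.exists_pos_le_gain R
  obtain ⟨α, hα, hα_lt⟩ := exists_between (lt_min hα₀ (by positivity : 0 < 1 / 2 / δ))
  have hαδ : α * δ < 1 / 2 := (lt_div_iff₀ hδ).1 (hα_lt.trans_le (min_le_right _ _))
  refine (h.isBigO_rpow_neg_of_eventually_le hp hα hαδ (hR.mono fun k hk =>
    (hα_lt.le.trans (min_le_left _ _)).trans (hle k hk))).trans_tendsto ?_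
  exact (tendsto_rpow_neg_atTop (mul_pos hα hδ)).comp tendsto_natCast_atTop_atTop

theorem eventually_le_gain (h : ErrorRecursion p x ξ a A lam) (hp : IsExciting p M δ N) {α : ℝ}
    (hα : α < lam) : ∀ᶠ k in atTop, α ≤ a k := by
  obtain ⟨r, hr, hle⟩ := h.exists_le_gain α hα
  filter_upwards [(h.tendsto_zero hp).norm.eventually_le_const (by simpa using hr)] with k hk
  exact hle k hk

theorem isBigO_rpow_neg (h : ErrorRecursion p x ξ a A lam) (hp : IsExciting p M δ N)
    (hs : s < lam * δ) (hs' : s < 1 / 2) : x =O[atTop] fun k : ℕ => (k : ℝ) ^ (-s) := by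
  have hδ : 0 < δ := hp.delta_pos
  have : 0 < lam * δ := mul_pos h.limit_pos hδ
  obtain ⟨t, hst, ht⟩ := exists_between (max_lt (lt_min hs hs') (lt_min this one_half_pos))
  obtain ⟨ht_lam, ht_half⟩ := lt_min_iff.1 ht
  obtain ⟨hst, ht_pos⟩ := max_lt_iff.1 hst
  have htδ : t / δ * δ = t := div_mul_cancel₀ t hδ.ne'
  have hx := h.isBigO_rpow_neg_of_eventually_le hp (div_pos ht_pos hδ) (htδ.trans_lt ht_half)
    (h.eventually_le_gain hp ((div_lt_iff₀ hδ).2 ht_lam))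
  exact hx.trans (natCast_rpow_isBigO_rpow (by linarith))

theorem isBigO_sqrtLogLog_mul_rpow (h : ErrorRecursion p x ξ a A lam) (hp : IsExciting p M δ N)
    (hlam : 1 / 2 < lam * δ) :
    x =O[atTop] fun k : ℕ => sqrtLogLog k * (k : ℝ) ^ (-(1 / 2) : ℝ) := by
  have hδ : 0 < δ := hp.delta_pos
  obtain ⟨t, ht_half, ht⟩ := exists_between (lt_min hlam (by norm_num : (1 / 2 : ℝ) < 3 / 2))
  obtain ⟨ht_lam, ht_lt⟩ := lt_min_iff.1 ht
  have htδ : t / δ * δ = t := div_mul_cancel₀ t hδ.ne'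
  obtain ⟨e, hz, he⟩ := h.exists_isGradientPath_sub_runningMean hp.norm_le
  have hgain : ∀ᶠ k in atTop, a k ∈ Set.Icc (t / δ) A :=
    (h.eventually_le_gain hp ((div_lt_iff₀ hδ).2 ht_lam)).mono fun k hk => ⟨hk, h.gain_le k⟩
  exact h.isBigO_of_sub_runningMean (isBigO_refl _ _) (hz.isBigO_sqrtLogLog_mul_rpow hp
    (div_pos (by linarith : 0 < t) hδ) hgain (by rwa [htδ]) (by rwa [htδ]) he)

-- The gains fall short of `lam` by `O(‖x k‖)`, so raising them to `lam` costs only a perturbation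
-- of quadratic order in the rate already known.
theorem exists_isGradientPath_max_gain (h : ErrorRecursion p x ξ a A lam) (hp : IsExciting p M δ N)
    (hL : ∀ r > 0, r ≤ 1 → ∀ k, ‖x k‖ ≤ r → lam - L * r ≤ a k) (hs : 0 < s)
    (hs' : s < 1 / 2) (hs_lam : s < lam * δ) :
    ∃ e e', IsGradientPath p (fun k => max (a k) lam / (k + 1)) (e + e') (x - runningMean ξ) ∧
      (e =O[atTop] fun k : ℕ => sqrtLogLog k * (k : ℝ) ^ (-(3 / 2) : ℝ)) ∧
      e' =O[atTop] fun k : ℕ => (k : ℝ) ^ (-1 + (-s + -s)) := by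
  have hx := h.isBigO_rpow_neg hp hs_lam hs'
  obtain ⟨e, hz, he⟩ := h.exists_isGradientPath_sub_runningMean hp.norm_le
  have hz_rate : (x - runningMean ξ) =O[atTop] fun k : ℕ => (k : ℝ) ^ (-s) :=
    hx.sub ((runningMean_isBigO h.noise).trans (sqrtLogLog_mul_rpow_isBigO_rpow (neg_lt_neg hs')))
  refine ⟨e, _, hz.change_gain fun k => max (a k) lam / (k + 1), he, ?_⟩
  refine (smul_inner_smul_isBigO hp.norm_le _ _).trans ?_
  have hprod := inv_natCast_add_one_isBigO.mul
    (((max_sub_isBigO_rpow_neg hL hs hx).mul hz_rate.norm_left).trans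
      (natCast_rpow_mul_rpow_eventuallyEq (-s) (-s)).isBigO)
  refine (hprod.trans (natCast_rpow_mul_rpow_eventuallyEq _ _).isBigO).congr_left fun k => ?_
  ring

theorem eventually_max_gain_mem_Icc (h : ErrorRecursion p x ξ a A lam) :
    ∀ᶠ k in atTop, max (a k) lam ∈ Set.Icc lam (max A lam) :=
  Eventually.of_forall fun k => ⟨le_max_right _ _, max_le_max_right _ (h.gain_le k)⟩

theorem isBigO_rpow_neg_of_lipschitz (h : ErrorRecursion p x ξ a A lam) (hp : IsExciting p M δ N)
    (hL : ∀ r > 0, r ≤ 1 → ∀ k, ‖x k‖ ≤ r → lam - L * r ≤ a k) (hlam : lam * δ < 1 / 2) :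
    x =O[atTop] fun k : ℕ => (k : ℝ) ^ (-(lam * δ)) := by
  have hpos : 0 < lam * δ := mul_pos h.limit_pos hp.delta_pos
  obtain ⟨e, e', hz, he, he'⟩ := h.exists_isGradientPath_max_gain hp hL
    (s := 3 / 4 * (lam * δ)) (by linarith) (by linarith) (by linarith)
  refine h.isBigO_of_sub_runningMean (sqrtLogLog_mul_rpow_isBigO_rpow (neg_lt_neg hlam))
    (hz.isBigO_rpow_neg_of_summable hp h.limit_pos h.eventually_max_gain_mem_Icc ?_)
  refine Summable.of_nonneg_of_le (fun k => by positivity) (fun k => ?_)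
    ((summable_rpow_mul_norm_of_isBigO (s := lam * δ) (by linarith) he).add
      (summable_rpow_mul_of_isBigO (s := lam * δ) (by linarith) he'.norm_left))
  rw [← mul_add]
  gcongr
  exact norm_add_le _ _

theorem isBigO_log_mul_sqrtLogLog_mul_rpow_of_lipschitz (h : ErrorRecursion p x ξ a A lam)
    (hp : IsExciting p M δ N) (hL : ∀ r > 0, r ≤ 1 → ∀ k, ‖x k‖ ≤ r → lam - L * r ≤ a k)
    (hlam : lam * δ = 1 / 2) :
    x =O[atTop] fun k : ℕ => Real.log k * (sqrtLogLog k * (k : ℝ) ^ (-(1 / 2) : ℝ)) := by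
  obtain ⟨e, e', hz, he, he'⟩ := h.exists_isGradientPath_max_gain hp hL (s := 1 / 4)
    (by norm_num) (by norm_num) (by rw [hlam]; norm_num)
  have he'_rate := he'.trans
    (natCast_rpow_isBigO_sqrtLogLog_mul_rpow (s := -(3 / 2)) (by norm_num))
  refine h.isBigO_of_sub_runningMean
    ((one_isBigO_log_natCast.mul (isBigO_refl _ _)).congr_left fun k => one_mul _)
    (hz.isBigO_log_mul_sqrtLogLog_mul_rpow hp h.limit_pos h.eventually_max_gain_mem_Icc hlam
      (he.add he'_rate))

end ErrorRecursion

end ErrorRecursion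

section SecantSlope

variable {F : ℝ → ℝ} {K : NNReal} {ℓ : ℝ} {s : Set ℝ}

/-- The slope of the secant of `F` through `u` and `v`, with the value `K` on the diagonal. For a
`K`-Lipschitz function `F`, bounds on the growth of `F` are then bounds on `secantSlope F K`. -/
noncomputable def secantSlope (F : ℝ → ℝ) (K u v : ℝ) : ℝ :=
  Function.update (slope F u) u K v

theorem secantSlope_self (F : ℝ → ℝ) (K u : ℝ) : secantSlope F K u u = K :=
  Function.update_self (β := fun _ => ℝ) u K _

theorem secantSlope_of_ne (F : ℝ → ℝ) (K : ℝ) {u v : ℝ} (h : v ≠ u) :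
    secantSlope F K u v = slope F u v :=
  Function.update_of_ne (β := fun _ => ℝ) h K _

theorem secantSlope_mul_sub (F : ℝ → ℝ) (K u v : ℝ) :
    secantSlope F K u v * (v - u) = F v - F u := by
  rcases eq_or_ne v u with rfl | h
  · simp
  · rw [secantSlope_of_ne F K h, mul_comm]
    exact sub_smul_slope F u v

theorem secantSlope_le (hF : LipschitzWith K F) (u v : ℝ) : secantSlope F K u v ≤ K := by
  rcases eq_or_ne v u with rfl | h
  · exact (secantSlope_self F K v).le
  · rw [secantSlope_of_ne F K h, slope_def_field]
    refine (le_abs_self _).trans ?_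
    rw [abs_div, div_le_iff₀ (abs_pos.2 (sub_ne_zero.2 h))]
    exact hF.dist_le_mul v u

theorem le_slope_of_monotoneOn_sub_mul (hF : MonotoneOn (fun x => F x - ℓ * x) s) {u v : ℝ}
    (hu : u ∈ s) (hv : v ∈ s) (h : v ≠ u) : ℓ ≤ slope F u v := by
  rw [slope_def_field]
  rcases lt_or_gt_of_ne h with hvu | huv
  · rw [le_div_iff_of_neg (sub_neg.2 hvu)]
    linarith [hF hv hu hvu.le]
  · rw [le_div_iff₀ (sub_pos.2 huv)]
    linarith [hF hu hv huv.le]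

theorem le_secantSlope (hK : LipschitzWith K F) (hF : MonotoneOn (fun x => F x - ℓ * x) s)
    (hs : s.Nontrivial) {u v : ℝ} (hu : u ∈ s) (hv : v ∈ s) : ℓ ≤ secantSlope F K u v := by
  rcases eq_or_ne v u with rfl | h
  · obtain ⟨x, hx, y, hy, hxy⟩ := hs
    calc ℓ ≤ slope F x y := le_slope_of_monotoneOn_sub_mul hF hx hy hxy.symm
      _ = secantSlope F K x y := (secantSlope_of_ne F K hxy.symm).symm
      _ ≤ K := secantSlope_le hK x y
      _ = secantSlope F K v v := (secantSlope_self F K v).symm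
  · exact (le_slope_of_monotoneOn_sub_mul hF hu hv h).trans_eq (secantSlope_of_ne F K h).symm

theorem monotoneOn_cdf_sub_mul {ν : Measure ℝ} [IsProbabilityMeasure ν] {f : ℝ → ℝ}
    (hf : Measurable f) (hν : ν = volume.withDensity fun x => ENNReal.ofReal (f x))
    (hs : s.OrdConnected) (hℓ : ∀ x ∈ s, ℓ ≤ f x) :
    MonotoneOn (fun x => cdf ν x - ℓ * x) s := by
  intro u hu v hv huv
  have hmeasure : ν (Set.Ioc u v) = ENNReal.ofReal (cdf ν v - cdf ν u) := by
    rw [← StieltjesFunction.measure_Ioc, measure_cdf]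
  have hle : ENNReal.ofReal (ℓ * (v - u)) ≤ ν (Set.Ioc u v) := by
    rw [hν, withDensity_apply _ measurableSet_Ioc, ENNReal.ofReal_mul' (sub_nonneg.2 huv),
      ← Real.volume_Ioc, ← setLIntegral_const]
    exact setLIntegral_mono hf.ennreal_ofReal fun x hx =>
      ENNReal.ofReal_le_ofReal (hℓ x (hs.out hu hv (Set.Ioc_subset_Icc_self hx)))
  rw [hmeasure, ENNReal.ofReal_le_ofReal_iff (sub_nonneg.2 (monotone_cdf ν huv))] at hle
  linarith

end SecantSlope

section LowerDensity

variable {f : ℝ → ℝ} {C a b z ℓ : ℝ}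

theorem sInf_image_le_of_nonneg (hf : ∀ x, 0 ≤ f x) {s : Set ℝ} {t : ℝ} (ht : t ∈ s) :
    sInf (f '' s) ≤ f t :=
  csInf_le ⟨0, by rintro _ ⟨x, -, rfl⟩; exact hf x⟩ (Set.mem_image_of_mem f ht)

theorem lowerDensity_le (hf : ∀ x, 0 ≤ f x) (ha : 0 ≤ a) {t : ℝ}
    (ht : t ∈ Set.Icc (C - a) (C + a)) : lowerDensity f C a ≤ f t := by
  refine le_of_tendsto (tendsto_lowerDensity hf C ha) ?_
  filter_upwards [self_mem_nhdsWithin] with z (hz : a < z)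
  exact sInf_image_le_of_nonneg hf (Set.Icc_subset_Icc (by linarith) (by linarith) ht)

theorem le_lowerDensity (hf : ∀ x, 0 ≤ f x) (ha : 0 ≤ a) (haz : a < z)
    (hℓ : ∀ t ∈ Set.Icc (C - z) (C + z), ℓ ≤ f t) : ℓ ≤ lowerDensity f C a := by
  refine ge_of_tendsto (tendsto_lowerDensity hf C ha) ?_
  filter_upwards [Ioo_mem_nhdsGT haz] with w hw
  refine le_csInf ((Set.nonempty_Icc.2 (by linarith [hw.1])).image f) ?_
  rintro _ ⟨t, ht, rfl⟩
  exact hℓ t (Set.Icc_subset_Icc (by linarith [hw.2]) (by linarith [hw.2]) ht)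

theorem exists_gt_forall_le_of_lt_lowerDensity (hf : ∀ x, 0 ≤ f x) (ha : 0 ≤ a)
    (hℓ : ℓ < lowerDensity f C a) : ∃ z > a, ∀ t ∈ Set.Icc (C - z) (C + z), ℓ ≤ f t := by
  obtain ⟨z, hz, haz⟩ := (((tendsto_lowerDensity hf C ha).eventually_const_le hℓ).and
    self_mem_nhdsWithin).exists
  exact ⟨z, haz, fun t ht => hz.trans (sInf_image_le_of_nonneg hf ht)⟩

theorem exists_mem_Icc_dist_le (ha : 0 ≤ a) (haz : a ≤ z) {t : ℝ}
    (ht : t ∈ Set.Icc (C - z) (C + z)) : ∃ t' ∈ Set.Icc (C - a) (C + a), dist t' t ≤ z - a := by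
  refine ⟨max (C - a) (min t (C + a)), ⟨le_max_left _ _, max_le (by linarith)
    (min_le_right _ _)⟩, abs_le.2 ?_⟩
  obtain ⟨hlo, hhi⟩ := ht
  rcases max_cases (C - a) (min t (C + a)) with h | h <;>
  rcases min_cases t (C + a) with h' | h' <;> constructor <;> linarith

theorem exists_lowerDensity_sub_mul_le (hf : ∀ x, 0 ≤ f x) (hf_lip : LocallyLipschitz f)
    (C : ℝ) (ha : 0 ≤ a) (b : ℝ) : ∃ L, ∀ z ∈ Set.Icc a b, ∀ t ∈ Set.Icc (C - z) (C + z),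
      lowerDensity f C a - L * (z - a) ≤ f t := by
  obtain ⟨L, hL⟩ := (hf_lip.locallyLipschitzOn
    (s := Set.Icc (C - b) (C + b))).exists_lipschitzOnWith_of_compact isCompact_Icc
  refine ⟨L, fun z hz t ht => ?_⟩
  have hsub {w : ℝ} (hw : w ≤ b) : Set.Icc (C - w) (C + w) ⊆ Set.Icc (C - b) (C + b) :=
    Set.Icc_subset_Icc (by linarith) (by linarith)
  obtain ⟨t', ht', hdist⟩ := exists_mem_Icc_dist_le ha hz.1 ht
  have hft : f t' - f t ≤ L * (z - a) := (le_abs_self _).trans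
    ((hL.dist_le_mul t' (hsub (hz.1.trans hz.2) ht') t (hsub hz.2 ht)).trans (by gcongr))
  linarith [lowerDensity_le hf ha ht']

end LowerDensity

/-- I.i.d. noise `d 1, d 2, …` with Lipschitz distribution function `F` and a density `f` that is
bounded below by a positive constant on each bounded open set. -/
structure DensityNoise {Ω : Type*} [MeasurableSpace Ω] (μ : Measure Ω) (d : ℕ → Ω → ℝ)
    (F f : ℝ → ℝ) : Prop where
  measurable : ∀ k, 1 ≤ k → Measurable (d k)
  indep : iIndepFun (fun k : ℕ => d (k + 1)) μ
  identDistrib : ∀ k, 1 ≤ k → IdentDistrib (d k) (d 1) μ μ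
  distribution : ∀ x, F x = μ.real {ω | d 1 ω ≤ x}
  lipschitz : ∃ K, LipschitzWith K F
  density_measurable : Measurable f
  density : μ.map (d 1) = volume.withDensity (fun x => ENNReal.ofReal (f x))
  density_inf_pos : ∀ X : Set ℝ, IsOpen X → Bornology.IsBounded X →
    ∃ c : ℝ, 0 < c ∧ ∀ x ∈ X, c ≤ f x

theorem NoiseAssumption.toDensityNoise {Ω : Type*} [MeasurableSpace Ω] {μ : Measure Ω}
    {d : ℕ → Ω → ℝ} {F f : ℝ → ℝ} (hd : NoiseAssumption μ d F f) : DensityNoise μ d F f :=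
  { hd with }

theorem PersistentExcitation.isExciting {n : ℕ} {φ : ℕ → EuclideanSpace ℝ (Fin n)} {M δ : ℝ}
    {N : ℕ} (hφ : PersistentExcitation φ M δ N) : IsExciting (fun k => φ (k + 1)) M δ N where
  window_pos := hφ.window_pos
  delta_pos := hφ.delta_pos
  norm_le k := hφ.bounded (k + 1) k.succ_pos
  exciting k v := by
    have hN : (0 : ℝ) < N := Nat.cast_pos.2 hφ.window_pos
    have hinner (u w : EuclideanSpace ℝ (Fin n)) : u.ofLp ⬝ᵥ w.ofLp = inner ℝ u w := by
      rw [EuclideanSpace.inner_eq_star_dotProduct, dotProduct_comm]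
      rfl
    have hnorm : v.ofLp ⬝ᵥ v.ofLp = ‖v‖ ^ 2 := by rw [hinner, real_inner_self_eq_norm_sq]
    have hterm (i : ℕ) : v.ofLp ⬝ᵥ (Matrix.vecMulVec (φ i).ofLp (φ i).ofLp).mulVec v.ofLp =
        inner ℝ (φ i) v ^ 2 := by
      rw [Matrix.vecMulVec_mulVec, dotProduct_smul, hinner, hinner, real_inner_comm, sq]
      rfl
    have h := (hφ.exciting (k + 1) k.succ_pos).dotProduct_mulVec_nonneg v.ofLp
    simp only [star_trivial, Matrix.sub_mulVec, dotProduct_sub, Matrix.smul_mulVec,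
      Matrix.one_mulVec, dotProduct_smul, Matrix.sum_mulVec, dotProduct_sum, hterm, hnorm,
      smul_eq_mul, sub_nonneg] at h
    rw [Finset.sum_Ico_eq_sum_range, Nat.add_sub_cancel_left, one_div, ← div_eq_inv_mul,
      le_div_iff₀ hN] at h
    calc N * δ * ‖v‖ ^ 2 = δ * ‖v‖ ^ 2 * N := by ring
      _ ≤ _ := h
      _ = _ := by simp only [add_right_comm]

namespace DensityNoise

variable {Ω : Type*} [MeasurableSpace Ω] {μ : Measure Ω} {d : ℕ → Ω → ℝ} {F f : ℝ → ℝ}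

theorem exists_pos_le_on_Icc (hd : DensityNoise μ d F f) (p q : ℝ) :
    ∃ c > 0, ∀ x ∈ Set.Icc p q, c ≤ f x := by
  obtain ⟨c, hc, hle⟩ := hd.density_inf_pos (Set.Ioo (p - 1) (q + 1)) isOpen_Ioo
    (Metric.isBounded_Ioo _ _)
  exact ⟨c, hc, fun x hx => hle x ⟨by linarith [hx.1], by linarith [hx.2]⟩⟩

theorem density_nonneg (hd : DensityNoise μ d F f) (x : ℝ) : 0 ≤ f x := by
  obtain ⟨c, hc, hle⟩ := hd.exists_pos_le_on_Icc x x
  exact hc.le.trans (hle x ⟨le_rfl, le_rfl⟩)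

theorem lowerDensity_pos (hd : DensityNoise μ d F f) (C : ℝ) {a : ℝ} (ha : 0 ≤ a) :
    0 < lowerDensity f C a := by
  obtain ⟨c, hc, hle⟩ := hd.exists_pos_le_on_Icc (C - (a + 1)) (C + (a + 1))
  exact hc.trans_le (le_lowerDensity hd.density_nonneg ha (lt_add_one a) hle)

variable [IsProbabilityMeasure μ]

theorem eq_cdf (hd : DensityNoise μ d F f) : F = cdf (μ.map (d 1)) := by
  have hm := hd.measurable 1 le_rfl
  have := Measure.isProbabilityMeasure_map (μ := μ) hm.aemeasurable
  funext x
  rw [hd.distribution, cdf_eq_real, map_measureReal_apply hm measurableSet_Iic]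
  rfl

theorem monotoneOn_sub_mul (hd : DensityNoise μ d F f) {ℓ : ℝ} {s : Set ℝ} (hs : s.OrdConnected)
    (hℓ : ∀ x ∈ s, ℓ ≤ f x) : MonotoneOn (fun x => F x - ℓ * x) s := by
  have := Measure.isProbabilityMeasure_map (μ := μ) (hd.measurable 1 le_rfl).aemeasurable
  rw [hd.eq_cdf]
  exact monotoneOn_cdf_sub_mul hd.density_measurable hd.density hs hℓ

end DensityNoise

/-- The centred binary observation at time `k + 1`, with the sign it has in the recursion. -/
noncomputable def observationNoise {n : ℕ} {Ω : Type*} (F : ℝ → ℝ)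
    (φ : ℕ → EuclideanSpace ℝ (Fin n)) (θ : EuclideanSpace ℝ (Fin n)) (d : ℕ → Ω → ℝ) (C : ℝ)
    (k : ℕ) (ω : Ω) : ℝ :=
  F (C - inner ℝ (φ (k + 1)) θ) - observation φ θ d C (k + 1) ω

theorem observationNoise_eq_indicator {n : ℕ} {Ω : Type*} (F : ℝ → ℝ)
    (φ : ℕ → EuclideanSpace ℝ (Fin n)) (θ : EuclideanSpace ℝ (Fin n)) (d : ℕ → Ω → ℝ) (C : ℝ)
    (k : ℕ) :
    observationNoise F φ θ d C k = (fun x => F (C - inner ℝ (φ (k + 1)) θ) -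
      (Set.Iic (C - inner ℝ (φ (k + 1)) θ)).indicator 1 x) ∘ d (k + 1) := by
  funext ω
  simp only [observationNoise, observation, output, Function.comp_apply, Set.indicator_apply,
    Set.mem_Iic, le_sub_iff_add_le', Pi.one_apply]
  congr

theorem measurable_sub_indicator_Iic (y c : ℝ) :
    Measurable fun x : ℝ => y - (Set.Iic c).indicator 1 x :=
  measurable_const.sub (measurable_one.indicator measurableSet_Iic)

namespace DensityNoise

variable {Ω : Type*} [MeasurableSpace Ω] {μ : Measure Ω} {n : ℕ}
  {φ : ℕ → EuclideanSpace ℝ (Fin n)} {d : ℕ → Ω → ℝ} {F f : ℝ → ℝ} {M : ℝ}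

theorem measurable_observationNoise (hd : DensityNoise μ d F f) (φ : ℕ → EuclideanSpace ℝ (Fin n))
    (θ : EuclideanSpace ℝ (Fin n)) (C : ℝ) (k : ℕ) :
    Measurable (observationNoise F φ θ d C k) := by
  rw [observationNoise_eq_indicator]
  exact (measurable_sub_indicator_Iic _ _).comp (hd.measurable (k + 1) k.succ_pos)

theorem iIndepFun_observationNoise (hd : DensityNoise μ d F f)
    (φ : ℕ → EuclideanSpace ℝ (Fin n)) (θ : EuclideanSpace ℝ (Fin n)) (C : ℝ) :
    iIndepFun (observationNoise F φ θ d C) μ := by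
  rw [funext (observationNoise_eq_indicator F φ θ d C)]
  exact hd.indep.comp _ fun k => measurable_sub_indicator_Iic _ _

variable [IsProbabilityMeasure μ]

theorem integral_observationNoise (hd : DensityNoise μ d F f)
    (φ : ℕ → EuclideanSpace ℝ (Fin n)) (θ : EuclideanSpace ℝ (Fin n)) (C : ℝ) (k : ℕ) :
    ∫ ω, observationNoise F φ θ d C k ω ∂μ = 0 := by
  set c := C - inner ℝ (φ (k + 1)) θ
  have hm := hd.measurable 1 le_rfl
  have := Measure.isProbabilityMeasure_map (μ := μ) hm.aemeasurable
  have hident := (hd.identDistrib (k + 1) k.succ_pos).comp (measurable_sub_indicator_Iic (F c) c)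
  have hint : Integrable ((Set.Iic c).indicator 1) (μ.map (d 1)) :=
    (integrable_const (1 : ℝ)).indicator measurableSet_Iic
  rw [observationNoise_eq_indicator, hident.integral_eq]
  simp only [Function.comp_apply]
  rw [← integral_map hm.aemeasurable (measurable_sub_indicator_Iic _ _).aestronglyMeasurable,
    integral_sub (integrable_const _) hint, integral_const, integral_indicator_one
    measurableSet_Iic, ← cdf_eq_real, ← hd.eq_cdf]
  simp

theorem observationNoise_mem_Icc (hd : DensityNoise μ d F f) (φ : ℕ → EuclideanSpace ℝ (Fin n))
    (θ : EuclideanSpace ℝ (Fin n)) (C : ℝ) (k : ℕ) (ω : Ω) :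
    observationNoise F φ θ d C k ω ∈ Set.Icc (-1) 1 := by
  have hF (x : ℝ) : F x ∈ Set.Icc 0 1 := by
    rw [hd.eq_cdf]
    exact ⟨cdf_nonneg _ x, cdf_le_one _ x⟩
  obtain ⟨h0, h1⟩ := hF (C - inner ℝ (φ (k + 1)) θ)
  unfold observationNoise observation
  split_ifs <;> constructor <;> linarith

theorem ae_sum_observationNoise_isBigO (hd : DensityNoise μ d F f)
    (hφ : ∀ k, ‖φ (k + 1)‖ ≤ M) (θ : EuclideanSpace ℝ (Fin n)) (C : ℝ) :
    ∀ᵐ ω ∂μ, (fun k => ∑ i ∈ Finset.range k, observationNoise F φ θ d C i ω • φ (i + 1))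
      =O[atTop] fun k : ℕ => sqrtLogLog k * (k : ℝ) ^ (1 / 2 : ℝ) := by
  simp only [← sqrt_mul_log_log]
  exact ae_sum_smul_isBigO_sqrt_mul_log_log (hd.measurable_observationNoise φ θ C)
    (hd.iIndepFun_observationNoise φ θ C)
    (fun k => hasSubgaussianMGF_of_mem_Icc_of_integral_eq_zero
      (hd.measurable_observationNoise φ θ C k).aemeasurable
      (Eventually.of_forall (hd.observationNoise_mem_Icc φ θ C k))
      (hd.integral_observationNoise φ θ C k)) hφ

end DensityNoise

section EstimationError

variable {n : ℕ} {φ : ℕ → EuclideanSpace ℝ (Fin n)} {β C M ℓ r z : ℝ} {F f : ℝ → ℝ} {K : NNReal}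

/-- The gain of the recursion at time `k + 1` when the estimation error is `x`: the factor of
`inner ℝ (φ (k + 1)) x` in the mean correction of the error, which makes the nonlinear recursion
formally linear. -/
noncomputable def gain {n : ℕ} (β C K : ℝ) (F : ℝ → ℝ) (φ : ℕ → EuclideanSpace ℝ (Fin n))
    (θ : EuclideanSpace ℝ (Fin n)) (k : ℕ) (x : EuclideanSpace ℝ (Fin n)) : ℝ :=
  β * secantSlope F K (C - inner ℝ (φ (k + 1)) θ) (C - inner ℝ (φ (k + 1)) (θ + x))

theorem gain_mul_inner (β C K : ℝ) (F : ℝ → ℝ) (φ : ℕ → EuclideanSpace ℝ (Fin n))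
    (θ : EuclideanSpace ℝ (Fin n)) (k : ℕ) (x : EuclideanSpace ℝ (Fin n)) :
    gain β C K F φ θ k x * inner ℝ (φ (k + 1)) x =
      β * (F (C - inner ℝ (φ (k + 1)) θ) - F (C - inner ℝ (φ (k + 1)) (θ + x))) := by
  have h := secantSlope_mul_sub F K (C - inner ℝ (φ (k + 1)) θ) (C - inner ℝ (φ (k + 1)) (θ + x))
  rw [gain, ← neg_sub (F _), ← h, inner_add_right]
  ring

theorem gain_le (hF : LipschitzWith K F) (hβ : 0 ≤ β) (C : ℝ) (φ : ℕ → EuclideanSpace ℝ (Fin n))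
    (θ : EuclideanSpace ℝ (Fin n)) (k : ℕ) (x : EuclideanSpace ℝ (Fin n)) :
    gain β C K F φ θ k x ≤ β * K :=
  mul_le_mul_of_nonneg_left (secantSlope_le hF _ _) hβ

theorem isGradientPath_estimationError {Ω : Type*} (β C K : ℝ) (F : ℝ → ℝ)
    (φ : ℕ → EuclideanSpace ℝ (Fin n)) (θ : EuclideanSpace ℝ (Fin n)) (d : ℕ → Ω → ℝ)
    (θ₀ : Ω → EuclideanSpace ℝ (Fin n)) (ω : Ω) :
    IsGradientPath (fun k => φ (k + 1))
      (fun k => gain β C K F φ θ k (estimationError β C F φ θ d θ₀ k ω) / (k + 1))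
      (fun k => ((k : ℝ) + 1)⁻¹ • β • observationNoise F φ θ d C k ω • φ (k + 1))
      (fun k => estimationError β C F φ θ d θ₀ k ω) := by
  intro k
  have hgain := gain_mul_inner β C K F φ θ k (estimationError β C F φ θ d θ₀ k ω)
  have hsucc : estimate β C F φ θ d θ₀ (k + 1) ω = estimate β C F φ θ d θ₀ k ω +
      (β / ((k + 1 : ℕ) : ℝ) * (F (C - inner ℝ (φ (k + 1)) (estimate β C F φ θ d θ₀ k ω)) -
        observation φ θ d C (k + 1) ω)) • φ (k + 1) := rfl
  have hestimate : θ + estimationError β C F φ θ d θ₀ k ω = estimate β C F φ θ d θ₀ k ω :=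
    add_sub_cancel _ _
  rw [hestimate] at hgain
  beta_reduce
  rw [div_mul_eq_mul_div, hgain, observationNoise, estimationError, hsucc, estimationError,
    Nat.cast_succ]
  module

theorem DensityNoise.le_gain {Ω : Type*} [MeasurableSpace Ω] {μ : Measure Ω}
    [IsProbabilityMeasure μ] {d : ℕ → Ω → ℝ} (hd : DensityNoise μ d F f) (hF : LipschitzWith K F)
    (hβ : 0 ≤ β) (hφ : ∀ k, ‖φ (k + 1)‖ ≤ M) {θ x : EuclideanSpace ℝ (Fin n)} (hx : ‖x‖ ≤ r)
    (hz : 0 < z) (hrz : M * (‖θ‖ + r) ≤ z) (hℓ : ∀ t ∈ Set.Icc (C - z) (C + z), ℓ ≤ f t) (k : ℕ) :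
    β * ℓ ≤ gain β C K F φ θ k x := by
  have hmem {v : EuclideanSpace ℝ (Fin n)} (hv : ‖v‖ ≤ ‖θ‖ + r) :
      C - inner ℝ (φ (k + 1)) v ∈ Set.Icc (C - z) (C + z) := by
    have h := abs_le.1 ((abs_inner_le_of_norm_le (hφ k) hv).trans hrz)
    exact ⟨by linarith [h.2], by linarith [h.1]⟩
  have hr : 0 ≤ r := (norm_nonneg x).trans hx
  have hnontrivial : (Set.Icc (C - z) (C + z)).Nontrivial :=
    ⟨C - z, ⟨le_rfl, by linarith⟩, C, ⟨by linarith, by linarith⟩, by linarith⟩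
  exact mul_le_mul_of_nonneg_left (le_secantSlope hF (hd.monotoneOn_sub_mul Set.ordConnected_Icc hℓ)
    hnontrivial (hmem (le_add_of_nonneg_right hr))
    (hmem ((norm_add_le θ x).trans (by gcongr)))) hβ

theorem DensityNoise.exists_lowerDensity_sub_mul_le_gain {Ω : Type*} [MeasurableSpace Ω]
    {μ : Measure Ω} [IsProbabilityMeasure μ] {d : ℕ → Ω → ℝ} (hd : DensityNoise μ d F f)
    (hF : LipschitzWith K F) (hf : LocallyLipschitz f) (hβ : 0 ≤ β)
    (hφ : ∀ k, ‖φ (k + 1)‖ ≤ M) (θ : EuclideanSpace ℝ (Fin n)) (C : ℝ) :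
    ∃ L, ∀ r > 0, r ≤ 1 → ∀ k x, ‖x‖ ≤ r →
      β * lowerDensity f C (M * ‖θ‖) - L * r ≤ gain β C K F φ θ k x := by
  have hM : 0 ≤ M := (norm_nonneg _).trans (hφ 0)
  obtain ⟨L, hL⟩ := exists_lowerDensity_sub_mul_le hd.density_nonneg hf C
    (a := M * ‖θ‖) (by positivity) (M * ‖θ‖ + (M + 1))
  refine ⟨β * (L * (M + 1)), fun r hr hr1 k x hx => ?_⟩
  have hz : M * ‖θ‖ + (M + 1) * r ∈ Set.Icc (M * ‖θ‖) (M * ‖θ‖ + (M + 1)) :=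
    ⟨le_add_of_nonneg_right (by positivity),
      add_le_add_right (mul_le_of_le_one_right (by positivity) hr1) _⟩
  calc _ = β * (lowerDensity f C (M * ‖θ‖) - L * (M * ‖θ‖ + (M + 1) * r - M * ‖θ‖)) := by ring
    _ ≤ _ := hd.le_gain hF hβ hφ hx (by positivity) (by linarith) (hL _ hz) k

theorem DensityNoise.errorRecursion {Ω : Type*} [MeasurableSpace Ω] {μ : Measure Ω}
    [IsProbabilityMeasure μ] {d : ℕ → Ω → ℝ} (hd : DensityNoise μ d F f) (hF : LipschitzWith K F)
    (hβ : 0 < β) (hφ : ∀ k, ‖φ (k + 1)‖ ≤ M) (θ : EuclideanSpace ℝ (Fin n))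
    (θ₀ : Ω → EuclideanSpace ℝ (Fin n)) {ω : Ω}
    (hω : (fun k => ∑ i ∈ Finset.range k, observationNoise F φ θ d C i ω • φ (i + 1))
      =O[atTop] fun k : ℕ => sqrtLogLog k * (k : ℝ) ^ (1 / 2 : ℝ)) :
    ErrorRecursion (fun k => φ (k + 1)) (fun k => estimationError β C F φ θ d θ₀ k ω)
      (fun k => β • observationNoise F φ θ d C k ω • φ (k + 1))
      (fun k => gain β C K F φ θ k (estimationError β C F φ θ d θ₀ k ω))
      (β * K) (β * lowerDensity f C (M * ‖θ‖)) := by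
  have hM : 0 ≤ M := (norm_nonneg _).trans (hφ 0)
  have hMθ : 0 ≤ M * ‖θ‖ := by positivity
  constructor
  case path => exact isGradientPath_estimationError β C K F φ θ d θ₀ ω
  case noise =>
    simp only [← Finset.smul_sum]
    exact hω.const_smul_left β
  case gain_le => exact fun k => gain_le hF hβ.le C φ θ k _
  case exists_pos_le_gain =>
    intro R
    set z := M * (‖θ‖ + |R|) + 1
    obtain ⟨c, hc, hle⟩ := hd.exists_pos_le_on_Icc (C - z) (C + z)
    exact ⟨β * c, mul_pos hβ hc, fun k hk => hd.le_gain hF hβ.le hφ (hk.trans (le_abs_self R))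
      (by positivity) (le_add_of_nonneg_right zero_le_one) hle k⟩
  case exists_le_gain =>
    intro α hα
    obtain ⟨z, hz, hle⟩ := exists_gt_forall_le_of_lt_lowerDensity hd.density_nonneg hMθ
      ((div_lt_iff₀' hβ).2 hα)
    have hr : 0 < (z - M * ‖θ‖) / (M + 1) := div_pos (sub_pos.2 hz) (by positivity)
    have hr_eq : (M + 1) * ((z - M * ‖θ‖) / (M + 1)) = z - M * ‖θ‖ :=
      mul_div_cancel₀ _ (by positivity)
    refine ⟨_, hr, fun k hk => ?_⟩
    simpa [mul_div_cancel₀ α hβ.ne'] using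
      hd.le_gain hF hβ.le hφ hk (hMθ.trans_lt hz) (by linarith) hle k
  case limit_pos => exact mul_pos hβ (hd.lowerDensity_pos C hMθ)

end EstimationError

end SetValued

theorem theorem5_general {Ω : Type*} [MeasurableSpace Ω] (μ : Measure Ω) [IsProbabilityMeasure μ]
    {n : ℕ} (φ : ℕ → EuclideanSpace ℝ (Fin n)) (θ : EuclideanSpace ℝ (Fin n))
    (d : ℕ → Ω → ℝ) (F f : ℝ → ℝ) (C M δ β η : ℝ) (N : ℕ)
    (θ₀ : Ω → EuclideanSpace ℝ (Fin n))
    (hφ : SetValued.PersistentExcitation φ M δ N)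
    (hd : SetValued.DensityNoise μ d F f)
    (hβ : 0 < β)
    (hη : η = β * δ * SetValued.lowerDensity f C (M * ‖θ‖)) :
    (∀ ε : ℝ, 0 < ε → ∀ᵐ ω ∂μ,
      (1 / 2 < η →
        (fun k : ℕ => SetValued.estimationError β C F φ θ d θ₀ k ω) =O[atTop]
          (fun k : ℕ => √(Real.log (Real.log (k : ℝ)) / (k : ℝ)))) ∧
      (η ≤ 1 / 2 →
        (fun k : ℕ => SetValued.estimationError β C F φ θ d θ₀ k ω) =O[atTop]
          (fun k : ℕ => 1 / (k : ℝ) ^ (η - ε)))) ∧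
    (LocallyLipschitz f → ∀ᵐ ω ∂μ,
      (1 / 2 < η →
        (fun k : ℕ => SetValued.estimationError β C F φ θ d θ₀ k ω) =O[atTop]
          (fun k : ℕ => √(Real.log (Real.log (k : ℝ)) / (k : ℝ)))) ∧
      (η = 1 / 2 →
        (fun k : ℕ => SetValued.estimationError β C F φ θ d θ₀ k ω) =O[atTop]
          (fun k : ℕ => Real.log (k : ℝ) * √(Real.log (Real.log (k : ℝ)) / (k : ℝ)))) ∧
      (η < 1 / 2 →
        (fun k : ℕ => SetValued.estimationError β C F φ θ d θ₀ k ω) =O[atTop]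
          (fun k : ℕ => 1 / (k : ℝ) ^ η))) := by
  obtain ⟨K, hK⟩ := hd.lipschitz
  have hp := hφ.isExciting
  obtain rfl : η = β * SetValued.lowerDensity f C (M * ‖θ‖) * δ := by rw [hη]; ring
  have hrec := (hd.ae_sum_observationNoise_isBigO hp.norm_le θ C).mono fun ω hω =>
    hd.errorRecursion hK hβ hp.norm_le θ θ₀ hω
  have hrpow (s : ℝ) (k : ℕ) : 1 / (k : ℝ) ^ s = (k : ℝ) ^ (-s) := by
    rw [Real.rpow_neg k.cast_nonneg, one_div]
  simp only [SetValued.sqrt_log_log_div, hrpow]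
  refine ⟨fun ε hε => ?_, fun hf => ?_⟩
  · filter_upwards [hrec] with ω h
    exact ⟨h.isBigO_sqrtLogLog_mul_rpow hp, fun _ =>
      h.isBigO_rpow_neg hp (by linarith) (by linarith)⟩
  · obtain ⟨L, hL⟩ := hd.exists_lowerDensity_sub_mul_le_gain hK hf hβ.le hp.norm_le θ C
    filter_upwards [hrec] with ω h
    have hgain := fun r hr hr1 k => hL r hr hr1 k
      (SetValued.estimationError β C F φ θ d θ₀ k ω)
    exact ⟨h.isBigO_sqrtLogLog_mul_rpow hp,
      h.isBigO_log_mul_sqrtLogLog_mul_rpow_of_lipschitz hp hgain,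
      h.isBigO_rpow_neg_of_lipschitz hp hgain⟩

theorem theorem5 {Ω : Type*} [MeasurableSpace Ω] (μ : Measure Ω) [IsProbabilityMeasure μ]
    {n : ℕ} (φ : ℕ → EuclideanSpace ℝ (Fin n)) (θ : EuclideanSpace ℝ (Fin n))
    (d : ℕ → Ω → ℝ) (F f : ℝ → ℝ) (C M δ β η : ℝ) (N : ℕ)
    (θ₀ : Ω → EuclideanSpace ℝ (Fin n))
    (hφ : SetValued.PersistentExcitation φ M δ N)
    (hd : SetValued.NoiseAssumption μ d F f)
    (hβ : 0 < β)
    (hη : η = β * δ * SetValued.lowerDensity f C (M * ‖θ‖)) :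
    (∀ ε : ℝ, 0 < ε → ∀ᵐ ω ∂μ,
      (1 / 2 < η →
        (fun k : ℕ => SetValued.estimationError β C F φ θ d θ₀ k ω) =O[atTop]
          (fun k : ℕ => √(Real.log (Real.log (k : ℝ)) / (k : ℝ)))) ∧
      (η ≤ 1 / 2 →
        (fun k : ℕ => SetValued.estimationError β C F φ θ d θ₀ k ω) =O[atTop]
          (fun k : ℕ => 1 / (k : ℝ) ^ (η - ε)))) ∧
    (LocallyLipschitz f → ∀ᵐ ω ∂μ,
      (1 / 2 < η →
        (fun k : ℕ => SetValued.estimationError β C F φ θ d θ₀ k ω) =O[atTop]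
          (fun k : ℕ => √(Real.log (Real.log (k : ℝ)) / (k : ℝ)))) ∧
      (η = 1 / 2 →
        (fun k : ℕ => SetValued.estimationError β C F φ θ d θ₀ k ω) =O[atTop]
          (fun k : ℕ => Real.log (k : ℝ) * √(Real.log (Real.log (k : ℝ)) / (k : ℝ)))) ∧
      (η < 1 / 2 →
        (fun k : ℕ => SetValued.estimationError β C F φ θ d θ₀ k ω) =O[atTop]
          (fun k : ℕ => 1 / (k : ℝ) ^ η))) := by
  exact theorem5_general μ φ θ d F f C M δ β η N θ₀ hφ hd.toDensityNoise hβ hη
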